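/- Let $K$ be a field of characteristic different from $2$ and $3$, with algebraic closure $\overline K$. For $\phi,\psi\in K(z)$ and a field $L\in\{K,\overline K\}$, say that $\phi$ and $\psi$ are \emph{conjugate over $L$} if $\psi=h^{-1}\circ\phi\circ h$ for some $h\in \mathrm{PGL}_2(L)$. The multiplier of a rational map $\phi$ at a finite fixed point $P$ is $\phi'(P)$, and its multiplier at a fixed point at $\infty$ is that of $1/\phi(1/z)$ at $0$. Let $\psi(z)\in K(z)$ have degree $2$, and let $\lambda_1,\lambda_2,\lambda_3\in\overline K$ be the multipliers of its fixed points in $\mathbb P^1(\overline K)$, counted with multiplicity and listed in any order. (a) If the multipliers are distinct, or if exactly two of them equal $1$, then $\sigma_1=\lambda_1+\lambda_2+\lambda_3$ and $\sigma_2=\lambda_1\lambda_2+\lambda_1\lambda_3+\lambda_2\lambda_3$ lie in $K$, and $\psi$ is conjugate over $K$ to $$\phi_{\sigma_1,\sigma_2}(z)=\frac{2z^2+(2-\sigma_1)z+(2-\sigma_1)}{-z^2+(2+\sigma_1)z+2-\sigma_1-\sigma_2}.$$ Furthermore, if $\sigma_1,\sigma_2,\sigma_1',\sigma_2'\in K$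 are such that $\phi_{\sigma_1,\sigma_2}$ and $\phi_{\sigma_1',\sigma_2'}$ have degree $2$ and are conjugate over $\overline K$, then $\sigma_1=\sigma_1'$ and $\sigma_2=\sigma_2'$. (b) If $\lambda_1=\lambda_2\neq 1$ and $\lambda_3\ne\lambda_1$, or if $\lambda_1=\lambda_2=\lambda_3=1$, then $k=\frac{\lambda_1+1}{2}$ lies in $K\smallsetminus\{0,-\tfrac12\}$, and $\psi$ is conjugate over $K$ to $\phi_{k,b}(z)=kz+\frac bz$ for some $b\in K^*$. Furthermore, for $k,k'\in K\smallsetminus\{0,-\tfrac12\}$ and $b,b'\in K^*$, the maps $\phi_{k,b}$ and $\phi_{k',b'}$ (which have degree $2$) are conjugate over $\overline K$ if and only if $k=k'$, and they are conjugate over $K$ if and only if $k=k'$ and $b/b'\in(K^*)^2$. (c) If $\lambda_1=\lambda_2=\lambda_3=-2$, then $\psi$ is conjugate over $K$ to a map of the form $$\theta_{d,k}(z)=\frac{kz^2-2dz+dk}{z^2-2kz+d},\qquad k\in K,\ d\in K^*,\ k^2\ne d.$$ All such maps have degree $2$ and are conjugate to each other over $\overline K$. Furthermore, two such maps $\theta_{d,k}$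 and $\theta_{d',k'}$ are conjugate over $K$ if and only if there are $b\in K^*$ and $\gamma\in K$ such that $d'=b^2d$ and $k'$ equals one of $$\frac{bd}{k},\qquad \frac{b\,(d^2\gamma^3+3dk\gamma^2+3d\gamma+k)}{dk\gamma^3+3d\gamma^2+3k\gamma+1}$$ (with the denominator of the expression in question nonzero). Every degree-$2$ map in $K(z)$ falls, up to reordering its multipliers, into exactly one of the cases (a), (b), (c). Moreover these lists give a complete description of the $K$-conjugacy classes: a degree-$2$ map in $K(z)$ is in case (a) (respectively (b), (c)) if and only if it is conjugate over $K$ to some $\phi_{\sigma_1,\sigma_2}$ with $\sigma_1,\sigma_2\in K$ (respectively some $\phi_{k,b}$ with $k\in K\smallsetminus\{0,-\frac12\}$, $b\in K^*$; some $\theta_{d,k}$ with $k\in K$, $d\in K^*$, $k^2\neq d$). -/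

import Mathlib

noncomputable section

namespace QuadraticMaps

open Polynomial

variable {F : Type*} [Field F]

/-- The degree of a rational map `φ = P / Q` in lowest terms: `max (deg P) (deg Q)`. -/
def ratDegree (φ : RatFunc F) : ℕ := max φ.num.natDegree φ.denom.natDegree

/-- Composition `φ ∘ g` in `F(z)`, by substituting `g` for the variable of `φ`. -/
def ratComp (φ g : RatFunc F) : RatFunc F := φ.eval RatFunc.C g

/-- The Möbius map `z ↦ (a z + b) / (c z + d)` of an invertible matrix with rows `(a, b)`
and `(c, d)`. -/
def mobius (h : GL (Fin 2) F) : RatFunc F :=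
  (RatFunc.C (h 0 0) * RatFunc.X + RatFunc.C (h 0 1)) /
    (RatFunc.C (h 1 0) * RatFunc.X + RatFunc.C (h 1 1))

/-- `φ^h = h⁻¹ ∘ φ ∘ h`. -/
def conjBy (h : GL (Fin 2) F) (φ : RatFunc F) : RatFunc F :=
  ratComp (mobius h⁻¹) (ratComp φ (mobius h))

/-- Conjugacy of rational maps over their field of coefficients. Scalar matrices act trivially, so
ranging over `GL₂` is the same as ranging over `PGL₂`. -/
def IsConj (φ ψ : RatFunc F) : Prop := ∃ h : GL (Fin 2) F, conjBy h φ = ψ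

/-- The derivative `φ'(x) = (P' Q - P Q')(x) / Q(x)²` at a finite point `x` that is not a pole. -/
def derivAt (φ : RatFunc F) (x : F) : F :=
  (derivative φ.num * φ.denom - φ.num * derivative φ.denom).eval x / (φ.denom.eval x) ^ 2

/-- `P(z) - z Q(z)`, whose roots are the finite fixed points of `φ = P / Q`. -/
def fixedPoly (φ : RatFunc F) : F[X] := φ.num - X * φ.denom

/-- The conjugate `1 / φ(1 / z)` of `φ`, which moves the point at infinity to `0`. -/
def atInfty (φ : RatFunc F) : RatFunc F := (ratComp φ (RatFunc.X)⁻¹)⁻¹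

/-- The multipliers of the fixed points of `φ` on the projective line over `F`, each repeated
according to the multiplicity of the fixed point. The point at infinity is treated through the
conjugate `1 / φ(1 / z)` at `0`. -/
def multipliers (φ : RatFunc F) : Multiset F :=
  (fixedPoly φ).roots.map (derivAt φ) +
    Multiset.replicate ((fixedPoly (atInfty φ)).rootMultiplicity 0) (derivAt (atInfty φ) 0)

variable {K : Type*} [Field K]

/-- A rational map over `K`, viewed over the algebraic closure of `K`. -/
def toBar (φ : RatFunc K) : RatFunc (AlgebraicClosure K) :=
  RatFunc.mapRingHom (mapRingHom (algebraMap K (AlgebraicClosure K)))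
    (nonZeroDivisors_le_comap_nonZeroDivisors_of_injective _
      (map_injective _ (algebraMap K (AlgebraicClosure K)).injective)) φ

/-- `l₁, l₂, l₃` is a listing of the multipliers of the fixed points of `φ` over the algebraic
closure of `K`, counted with multiplicity. -/
def HasMultipliers (φ : RatFunc K) (l₁ l₂ l₃ : AlgebraicClosure K) : Prop :=
  multipliers (toBar φ) = {l₁, l₂, l₃}

/-- The multipliers are distinct, or exactly two of them are `1`. -/
def CondA (l₁ l₂ l₃ : F) : Prop :=
  (l₁ ≠ l₂ ∧ l₁ ≠ l₃ ∧ l₂ ≠ l₃) ∨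
    (l₁ = 1 ∧ l₂ = 1 ∧ l₃ ≠ 1) ∨ (l₁ = 1 ∧ l₂ ≠ 1 ∧ l₃ = 1) ∨ (l₁ ≠ 1 ∧ l₂ = 1 ∧ l₃ = 1)

/-- `l₁ = l₂ ≠ 1` and `l₃ ≠ l₁`, or all three are `1`. -/
def CondB (l₁ l₂ l₃ : F) : Prop :=
  (l₁ = l₂ ∧ l₁ ≠ 1 ∧ l₃ ≠ l₁) ∨ (l₁ = 1 ∧ l₂ = 1 ∧ l₃ = 1)

/-- All three are `-2`. -/
def CondC (l₁ l₂ l₃ : F) : Prop := l₁ = -2 ∧ l₂ = -2 ∧ l₃ = -2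

/-- The map `φ` is in case (a). -/
def InCaseA (φ : RatFunc K) : Prop := ∃ l₁ l₂ l₃, HasMultipliers φ l₁ l₂ l₃ ∧ CondA l₁ l₂ l₃

/-- The map `φ` is in case (b). -/
def InCaseB (φ : RatFunc K) : Prop := ∃ l₁ l₂ l₃, HasMultipliers φ l₁ l₂ l₃ ∧ CondB l₁ l₂ l₃

/-- The map `φ` is in case (c). -/
def InCaseC (φ : RatFunc K) : Prop := ∃ l₁ l₂ l₃, HasMultipliers φ l₁ l₂ l₃ ∧ CondC l₁ l₂ l₃

/-- `(2 z² + (2 - s) z + (2 - s)) / (-z² + (2 + s) z + 2 - s - t)`. -/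
def formA (s t : K) : RatFunc K :=
  (2 * RatFunc.X ^ 2 + RatFunc.C (2 - s) * RatFunc.X + RatFunc.C (2 - s)) /
    (-RatFunc.X ^ 2 + RatFunc.C (2 + s) * RatFunc.X + RatFunc.C (2 - s - t))

/-- `k z + b / z`. -/
def formB (k b : K) : RatFunc K := RatFunc.C k * RatFunc.X + RatFunc.C b / RatFunc.X

/-- `θ_{d,k}(z) = (k z² - 2 d z + d k) / (z² - 2 k z + d)`. -/
def formC (d k : K) : RatFunc K :=
  (RatFunc.C k * RatFunc.X ^ 2 - RatFunc.C (2 * d) * RatFunc.X + RatFunc.C (d * k)) /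
    (RatFunc.X ^ 2 - RatFunc.C (2 * k) * RatFunc.X + RatFunc.C d)

end QuadraticMaps

end

noncomputable section

namespace QuadraticMaps

open Polynomial

variable {F : Type*} [Field F]

/-! A quadratic map is a pair `(P, Q)` of binary quadratic forms with nonzero resultant, up to a
common scalar, and conjugacy is an action of `GL₂` on the six coefficients (`isConj_toRat_iff`). Two
covariants govern it: the cubic `y P - x Q`, whose zeros are the fixed points, and the linear form
`∂P/∂x + ∂Q/∂y`, the divergence. By Euler's identity, at a fixed vector with `(P, Q) = μ (x, y)` the
divergence is `(2 + l) μ`, where `l` is the multiplier.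

If the divergence is nonzero, its zero can be moved to infinity, and on fixed points the multiplier
becomes a fractional linear function of the point. When this function is invertible, taking it as
coordinate gives a map each of whose fixed points is its own multiplier: this is `ofA`. When it
degenerates, the map is odd in a suitable coordinate and gives `ofB`. If the divergence vanishes,
every multiplier is `-2`; diagonalising the Jacobian form, whose zeros are the critical points,
gives `ofC`. This trichotomy, `rel_normal_form`, needs only `2 ≠ 0`.

Multipliers are conjugacy invariants, and on the normal forms they are explicit (`multList_ofA`,
`multList_ofB`, `multList_ofC`). They satisfy the conditions of (a), (b), (c) respectively, and
these conditions exclude one another, so the trichotomy of forms is the trichotomy of cases.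

Inside (a), the multipliers determine the parameters. Inside (b), a conjugation fixes `0`, the zero
of the divergence, and its image infinity, so it is a scaling. Inside (c), it must carry `x² - d y²`
to a multiple of `x² - d' y²`, which leaves the listed parameters. -/

/-- The coefficients of a pair of binary quadratic forms
`(a x² + b x y + c y², d x² + e x y + f y²)`, that is, of the self-map
`(a z² + b z + c) / (d z² + e z + f)` of the projective line. -/
@[ext]
structure Coeffs (F : Type*) where
  a : F
  b : F
  c : F
  d : F
  e : F
  f : F

/-! ### Pairs of quadratic forms and the conjugation action. -/

namespace Coeffs

/-- The resultant of the two quadratic forms. -/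
def res (q : Coeffs F) : F :=
  (q.a * q.f - q.c * q.d) ^ 2 - (q.a * q.e - q.b * q.d) * (q.b * q.f - q.c * q.e)

/-- Multiplication of all coefficients by a scalar. -/
def scale (w : F) (q : Coeffs F) : Coeffs F :=
  ⟨w * q.a, w * q.b, w * q.c, w * q.d, w * q.e, w * q.f⟩

/-- Substitution of `(α x + β y, γ x + δ y)` into the two quadratic forms. -/
def subst (α β γ δ : F) (q : Coeffs F) : Coeffs F :=
  ⟨q.a * α ^ 2 + q.b * α * γ + q.c * γ ^ 2,
    2 * q.a * α * β + q.b * (α * δ + β * γ) + 2 * q.c * γ * δ,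
    q.a * β ^ 2 + q.b * β * δ + q.c * δ ^ 2,
    q.d * α ^ 2 + q.e * α * γ + q.f * γ ^ 2,
    2 * q.d * α * β + q.e * (α * δ + β * γ) + 2 * q.f * γ * δ,
    q.d * β ^ 2 + q.e * β * δ + q.f * δ ^ 2⟩

/-- The linear combinations `(α P + β Q, γ P + δ Q)` of the two quadratic forms. -/
def comb (α β γ δ : F) (q : Coeffs F) : Coeffs F :=
  ⟨α * q.a + β * q.d, α * q.b + β * q.e, α * q.c + β * q.f,
    γ * q.a + δ * q.d, γ * q.b + δ * q.e, γ * q.c + δ * q.f⟩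

/-- Conjugation by the matrix with rows `(α, β)` and `(γ, δ)`. -/
def act (α β γ δ : F) (q : Coeffs F) : Coeffs F :=
  (q.subst α β γ δ).comb δ (-β) (-γ) α

/-- Conjugacy of quadratic maps, expressed by coefficients. -/
def Rel (q q' : Coeffs F) : Prop :=
  ∃ α β γ δ w : F, α * δ - β * γ ≠ 0 ∧ w ≠ 0 ∧ q' = (q.act α β γ δ).scale w

theorem res_scale (w : F) (q : Coeffs F) : (q.scale w).res = w ^ 4 * q.res := by
  simp only [res, scale]; ring

theorem res_subst (α β γ δ : F) (q : Coeffs F) :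
    (q.subst α β γ δ).res = (α * δ - β * γ) ^ 4 * q.res := by
  simp only [res, subst]; ring

theorem res_comb (α β γ δ : F) (q : Coeffs F) :
    (q.comb α β γ δ).res = (α * δ - β * γ) ^ 2 * q.res := by
  simp only [res, comb]; ring

theorem res_act (α β γ δ : F) (q : Coeffs F) :
    (q.act α β γ δ).res = (α * δ - β * γ) ^ 6 * q.res := by
  rw [act, res_comb, res_subst]; ring

theorem res_act_ne_zero {α β γ δ : F} {q : Coeffs F} (hd : α * δ - β * γ ≠ 0) (hq : q.res ≠ 0) :
    (q.act α β γ δ).res ≠ 0 := by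
  rw [res_act]; exact mul_ne_zero (pow_ne_zero _ hd) hq

theorem act_act (α β γ δ α' β' γ' δ' : F) (q : Coeffs F) :
    (q.act α β γ δ).act α' β' γ' δ' =
      q.act (α * α' + β * γ') (α * β' + β * δ') (γ * α' + δ * γ') (γ * β' + δ * δ') := by
  simp only [act, subst, comb]
  ext <;> ring

theorem act_scale (α β γ δ w : F) (q : Coeffs F) :
    (q.scale w).act α β γ δ = (q.act α β γ δ).scale w := by
  simp only [act, subst, comb, scale]
  ext <;> ring

/-- Substitution into quadratic forms contributes `t ^ 2`, the outer adjugate one more factor `t`.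
-/
theorem act_scalar (t : F) (q : Coeffs F) : q.act t 0 0 t = q.scale (t ^ 3) := by
  simp only [act, subst, comb, scale]
  ext <;> ring

theorem scale_scale (w w' : F) (q : Coeffs F) : (q.scale w).scale w' = q.scale (w' * w) := by
  simp only [scale, mul_assoc]

theorem scale_one (q : Coeffs F) : q.scale 1 = q := by
  simp only [scale, one_mul]

theorem Rel.refl (q : Coeffs F) : Rel q q :=
  ⟨1, 0, 0, 1, 1, by simp, one_ne_zero, by rw [act_scalar]; simp [scale_one]⟩

theorem Rel.trans {q q' q'' : Coeffs F} (h : Rel q q') (h' : Rel q' q'') : Rel q q'' := by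
  obtain ⟨α, β, γ, δ, w, hd, hw, rfl⟩ := h
  obtain ⟨α', β', γ', δ', w', hd', hw', rfl⟩ := h'
  refine ⟨α * α' + β * γ', α * β' + β * δ', γ * α' + δ * γ', γ * β' + δ * δ', w' * w, ?_,
    mul_ne_zero hw' hw, ?_⟩
  · convert mul_ne_zero hd hd' using 1; ring
  · rw [act_scale, act_act, scale_scale]

theorem Rel.symm {q q' : Coeffs F} (h : Rel q q') : Rel q' q := by
  obtain ⟨α, β, γ, δ, w, hd, hw, rfl⟩ := h
  -- The adjugate serves as inverse; the composite is a scalar matrix, acting by the cube of the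
  -- determinant.
  refine ⟨δ, -β, -γ, α, w⁻¹ * ((α * δ - β * γ) ^ 3)⁻¹, ?_, ?_, ?_⟩
  · convert hd using 1; ring
  · exact mul_ne_zero (inv_ne_zero hw) (inv_ne_zero (pow_ne_zero _ hd))
  · rw [act_scale, act_act,
      show α * δ + β * -γ = α * δ - β * γ by ring, show α * -β + β * α = 0 by ring,
      show γ * δ + δ * -γ = 0 by ring, show γ * -β + δ * α = α * δ - β * γ by ring, act_scalar,
      scale_scale, scale_scale]
    convert (scale_one q).symm using 2
    field_simp

theorem Rel.res_ne_zero {q q' : Coeffs F} (h : Rel q q') (hq : q.res ≠ 0) : q'.res ≠ 0 := by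
  obtain ⟨α, β, γ, δ, w, hd, hw, rfl⟩ := h
  rw [res_scale]
  exact mul_ne_zero (pow_ne_zero _ hw) (res_act_ne_zero hd hq)

theorem rel_act {α β γ δ : F} (q : Coeffs F) (hd : α * δ - β * γ ≠ 0) :
    Rel q (q.act α β γ δ) :=
  ⟨α, β, γ, δ, 1, hd, one_ne_zero, (scale_one _).symm⟩

/-! ### Reduction to normal forms by the divergence and the Jacobian. -/

/-- The coefficients of `(2 z² + (2 - s) z + (2 - s)) / (-z² + (2 + s) z + 2 - s - t)`. -/
def ofA (s t : F) : Coeffs F := ⟨2, 2 - s, 2 - s, -1, 2 + s, 2 - s - t⟩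

/-- The coefficients of `k z + b / z`. -/
def ofB (k b : F) : Coeffs F := ⟨k, 0, b, 0, 1, 0⟩

/-- The coefficients of `(k z² - 2 d z + d k) / (z² - 2 k z + d)`. -/
def ofC (d k : F) : Coeffs F := ⟨k, -(2 * d), d * k, 1, -(2 * k), d⟩

/-- Here `μ x = y (b x + c y)` and `(2 + l) μ = (b + 2 f) y` at a fixed vector, so `l = ((2 f - b) x
- 2 c y) / (b x + c y)`. The conjugating matrix is the adjugate of this Möbius map, so each fixed
point becomes its own multiplier. -/
theorem rel_ofA_of_odd {b c d f : F} (hc : c ≠ 0) (hn : b + 2 * f ≠ 0)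
    (hr : (⟨0, b, c, d, 0, f⟩ : Coeffs F).res ≠ 0) :
    ∃ s t, Rel ⟨0, b, c, d, 0, f⟩ (ofA s t) := by
  have hd' : d * c ^ 2 + f * b ^ 2 ≠ 0 := by
    intro h
    apply hr
    simp only [res]
    linear_combination d * h
  set D := d * c ^ 2 + f * b ^ 2 with hD
  -- The parameters are read off from the last two coefficients, `2 + s` and `2 - s - t`, of the
  -- conjugate.
  refine ⟨-(4 * d * c ^ 2 - 2 * f * b * (2 * f - b) - b ^ 2 * (b + 2 * f)) / D - 2,
    2 - (-(4 * d * c ^ 2 - 2 * f * b * (2 * f - b) - b ^ 2 * (b + 2 * f)) / D - 2) +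
      (b * (b + 2 * f) * (2 * f - b) + 4 * d * c ^ 2 + f * (2 * f - b) ^ 2) / D,
    c, 2 * c, -b, 2 * f - b, -1 / (c * D), ?_, ?_, ?_⟩
  · convert mul_ne_zero hc hn using 1; ring
  · exact div_ne_zero (by simp) (mul_ne_zero hc hd')
  · simp only [ofA, act, subst, comb, scale]
    ext <;> simp only <;> field_simp <;> rw [hD] <;> ring

/-- At a finite fixed point `μ = -2 a x`, so `l = -(4 a x + b y) / (2 a x)`, and this also gives the
correct value `-2` at infinity. The matrix is again the adjugate of this Möbius map. -/
theorem rel_ofA_of_linear_denom {a b c : F} (h2 : (2 : F) ≠ 0) (hb : b ≠ 0)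
    (hr : (⟨a, b, c, 0, -2 * a, 0⟩ : Coeffs F).res ≠ 0) :
    ∃ s t, Rel ⟨a, b, c, 0, -2 * a, 0⟩ (ofA s t) := by
  have ha : a ≠ 0 := by rintro rfl; apply hr; simp [res]
  have hc : c ≠ 0 := by rintro rfl; apply hr; simp [res]
  refine ⟨-1 / (8 * a ^ 3 * c) * (2 * a * (-2 * a * b ^ 2 + 16 * a ^ 2 * c)) - 2,
    2 - (-1 / (8 * a ^ 3 * c) * (2 * a * (-2 * a * b ^ 2 + 16 * a ^ 2 * c)) - 2) -
      -1 / (8 * a ^ 3 * c) * (2 * a * (16 * a ^ 2 * c - 3 * a * b ^ 2)),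
    0, b, -2 * a, -4 * a, -1 / (8 * a ^ 3 * c), ?_, ?_, ?_⟩
  · convert mul_ne_zero (mul_ne_zero h2 ha) hb using 1; ring
  · have h8 : (8 : F) ≠ 0 := by
      convert mul_ne_zero (mul_ne_zero h2 h2) h2 using 1; norm_num
    exact div_ne_zero (by simp) (mul_ne_zero (mul_ne_zero h8 (pow_ne_zero _ ha)) hc)
  · have h8 : (8 : F) ≠ 0 := by
      convert mul_ne_zero (mul_ne_zero h2 h2) h2 using 1; norm_num
    simp only [ofA, act, subst, comb, scale]
    ext <;> simp only <;> field_simp <;> ring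

/-- If the divergence `(2 a + e) x + (b + 2 f) y` is not zero, it can be moved to a multiple of
`y`. -/
theorem exists_rel_divergence {q : Coeffs F} (h : 2 * q.a + q.e ≠ 0 ∨ q.b + 2 * q.f ≠ 0) :
    ∃ q', Rel q q' ∧ q'.e = -2 * q'.a ∧ q'.b + 2 * q'.f ≠ 0 := by
  by_cases hm : 2 * q.a + q.e = 0
  · refine ⟨q, Rel.refl q, by linear_combination hm, ?_⟩
    simpa [hm] using h
  -- The first column is the zero of the divergence, so infinity is sent there.
  · refine ⟨_, rel_act (α := -(q.b + 2 * q.f)) (β := 1) (γ := 2 * q.a + q.e) (δ := 0) q ?_, ?_, ?_⟩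
    · intro h; apply hm; linear_combination -h
    · simp only [act, subst, comb]; ring
    · have : ∀ x : F, x = -(2 * q.a + q.e) ^ 2 → x ≠ 0 := by
        rintro x rfl; exact neg_ne_zero.2 (pow_ne_zero _ hm)
      apply this
      simp only [act, subst, comb]; ring

theorem rel_ofA_or_ofB_of_divergence {q : Coeffs F} (h2 : (2 : F) ≠ 0) (hr : q.res ≠ 0)
    (h : 2 * q.a + q.e ≠ 0 ∨ q.b + 2 * q.f ≠ 0) :
    (∃ s t, Rel q (ofA s t)) ∨ ∃ k b, k ≠ 0 ∧ k ≠ -1 / 2 ∧ b ≠ 0 ∧ Rel q (ofB k b) := by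
  obtain ⟨⟨a, b, c, d, e, f⟩, hq, he, hn⟩ := exists_rel_divergence h
  have hr := hq.res_ne_zero hr
  simp only at he hn
  subst he
  by_cases hd : d = 0
  · subst hd
    left
    have ha : a ≠ 0 := by rintro rfl; apply hr; simp [res]
    -- The finite pole is moved to `0`. Translations preserve a divergence that is a multiple of
    -- `y`.
    have h1 := rel_act (α := 1) (β := f / (2 * a)) (γ := 0) (δ := 1)
      (⟨a, b, c, 0, -2 * a, f⟩ : Coeffs F) (by simp)
    have h3 : ∃ b' c', b' ≠ 0 ∧ (⟨a, b, c, 0, -2 * a, f⟩ : Coeffs F).act 1 (f / (2 * a)) 0 1 =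
        ⟨a, b', c', 0, -2 * a, 0⟩ := by
      refine ⟨b + 2 * f,
        ((⟨a, b, c, 0, -2 * a, f⟩ : Coeffs F).act 1 (f / (2 * a)) 0 1).c, hn, ?_⟩
      · simp only [act, subst, comb]
        ext
        · simp
        · simp only; field_simp; ring
        · rfl
        · simp
        · simp
        · simp only; field_simp; ring
    obtain ⟨b', c', hb', h3⟩ := h3
    rw [h3] at h1
    obtain ⟨s, t, h4⟩ := rel_ofA_of_linear_denom h2 hb' (h1.res_ne_zero hr)
    exact ⟨s, t, hq.trans (h1.trans h4)⟩
  -- Since `e = -2 a`, a single translation kills both the first and the fifth coefficient.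
  · have h1 := rel_act (α := 1) (β := a / d) (γ := 0) (δ := 1)
      (⟨a, b, c, d, -2 * a, f⟩ : Coeffs F) (by simp)
    have h3 : ∃ b' c' f', b' + 2 * f' ≠ 0 ∧
        (⟨a, b, c, d, -2 * a, f⟩ : Coeffs F).act 1 (a / d) 0 1 = ⟨0, b', c', d, 0, f'⟩ := by
      refine ⟨b + 2 * a ^ 2 / d,
        ((⟨a, b, c, d, -2 * a, f⟩ : Coeffs F).act 1 (a / d) 0 1).c, f - a ^ 2 / d, ?_, ?_⟩
      · convert hn using 1; ring
      · simp only [act, subst, comb]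
        ext
        · simp only; field_simp; ring
        · simp only; field_simp; ring
        · rfl
        · simp
        · simp only; field_simp; ring
        · simp only; field_simp; ring
    obtain ⟨b', c', f', hn', h3⟩ := h3
    rw [h3] at h1
    have hr' := h1.res_ne_zero hr
    -- For `c' = 0` the Möbius map giving the multiplier degenerates: the map is `b' z / (d z² +
    -- f')`, and `z ↦ 1 / z` puts it in the form (b) with `k = f' / b'`. The value `k = -1/2` would
    -- make the divergence vanish.
    by_cases hc : c' = 0
    · subst hc
      right
      have hb' : b' ≠ 0 := by rintro rfl; apply hr'; simp [res]
      have hf' : f' ≠ 0 := by rintro rfl; apply hr'; simp [res]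
      refine ⟨f' / b', d / b', div_ne_zero hf' hb', ?_, div_ne_zero hd hb', hq.trans (h1.trans ?_)⟩
      · intro h
        rw [div_eq_div_iff hb' h2] at h
        apply hn'
        linear_combination h
      · refine ⟨0, 1, 1, 0, -1 / b', by simp, div_ne_zero (by simp) hb', ?_⟩
        simp only [ofB, act, subst, comb, scale]
        ext <;> simp only <;> field_simp <;> ring
    · left
      obtain ⟨s, t, h4⟩ := rel_ofA_of_odd hc hn' hr'
      exact ⟨s, t, hq.trans (h1.trans h4)⟩

/-- The Jacobian form `p x² + 2 q x y + r y²` of the pair of quadratic forms can be diagonalised. -/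
theorem exists_rel_diagonal (q : Coeffs F) (h2 : (2 : F) ≠ 0) :
    ∃ q', Rel q q' ∧ q'.a * q'.f - q'.c * q'.d = 0 := by
  have key : ∀ q : Coeffs F, q.a * q.e - q.b * q.d ≠ 0 →
      ∃ q', Rel q q' ∧ q'.a * q'.f - q'.c * q'.d = 0 := by
    intro q hp
    -- Completing the square in the Jacobian form.
    refine ⟨_, rel_act (α := 1) (β := -(q.a * q.f - q.c * q.d) / (q.a * q.e - q.b * q.d))
      (γ := 0) (δ := 1) q (by simp), ?_⟩
    have h (t : F) : (q.act 1 t 0 1).a * (q.act 1 t 0 1).f - (q.act 1 t 0 1).c * (q.act 1 t 0 1).d =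
        (q.a * q.e - q.b * q.d) * t + (q.a * q.f - q.c * q.d) := by
      simp only [act, subst, comb]; ring
    rw [h, mul_div_cancel₀ _ hp]; ring
  by_cases hq : q.a * q.f - q.c * q.d = 0
  · exact ⟨q, Rel.refl q, hq⟩
  by_cases hp : q.a * q.e - q.b * q.d = 0
  swap
  · exact key q hp
  by_cases hr : q.b * q.f - q.c * q.e = 0
  -- The Jacobian is now a multiple of `x y`, diagonal in the coordinates `x + y`, `x - y`.
  · refine ⟨_, rel_act (α := 1) (β := 1) (γ := 1) (δ := -1) q ?_, ?_⟩
    · intro h; apply h2; linear_combination -h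
    · simp only [act, subst, comb]
      linear_combination (-4) * hr + 4 * hp
  · have h := rel_act (α := 0) (β := 1) (γ := 1) (δ := 0) q (by simp)
    obtain ⟨q', h1, h3⟩ := key (q.act 0 1 1 0) (by
      simp only [act, subst, comb]
      intro h; apply hr; linear_combination h)
    exact ⟨q', h.trans h1, h3⟩

theorem rel_ofC_of_divergence {q : Coeffs F} (h2 : (2 : F) ≠ 0) (hr : q.res ≠ 0)
    (h : 2 * q.a + q.e = 0) (h' : q.b + 2 * q.f = 0) :
    ∃ d k, d ≠ 0 ∧ k ^ 2 ≠ d ∧ Rel q (ofC d k) := by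
  obtain ⟨⟨a, b, c, d, e, f⟩, hq, hH⟩ := exists_rel_diagonal q h2
  have hr := hq.res_ne_zero hr
  have hL : 2 * a + e = 0 ∧ b + 2 * f = 0 := by
    obtain ⟨α, β, γ, δ, w, hd, hw, hq⟩ := hq
    rw [Coeffs.ext_iff] at hq
    simp only [act, subst, comb, scale] at hq
    obtain ⟨h1, h2, h3, h4, h5, h6⟩ := hq
    constructor
    · rw [h1, h5]
      linear_combination w * (α * δ - β * γ) * (α * h + γ * h')
    · rw [h2, h6]
      linear_combination w * (α * δ - β * γ) * (β * h + δ * h')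
  obtain rfl : e = -2 * a := by linear_combination hL.1
  obtain rfl : b = -2 * f := by linear_combination hL.2
  simp only at hH
  -- Up to factors `2`, these are the two diagonal coefficients of the Jacobian, whose discriminant
  -- is the resultant.
  have hr' : (f * d - a ^ 2) * (a * c - f ^ 2) ≠ 0 := by
    intro h; apply hr
    simp only [res]; linear_combination (a * f - c * d) * hH - 4 * h
  by_cases hd : d = 0
  · subst hd
    have ha : a ≠ 0 := by rintro rfl; simp at hr'
    obtain rfl : f = 0 := by simpa [ha] using hH
    have hc : c ≠ 0 := by rintro rfl; simp at hr'
    refine ⟨a / c, 0, div_ne_zero ha hc, (by simpa using (div_ne_zero ha hc).symm), hq.trans ?_⟩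
    refine ⟨0, 1, 1, 0, -1 / c, by simp, div_ne_zero (by simp) hc, ?_⟩
    simp only [ofC, act, subst, comb, scale]
    ext <;> simp only <;> field_simp <;> ring
  · have hf : f ≠ 0 := by
      rintro rfl
      have hc : c = 0 := by simpa [hd] using hH
      simp [hc] at hr'
    refine ⟨f / d, a / d, div_ne_zero hf hd, ?_, hq.trans ?_⟩
    · intro h
      field_simp at h
      apply hr'
      linear_combination -(a * c - f ^ 2) * h
    · refine ⟨1, 0, 0, 1, 1 / d, by simp, div_ne_zero (by simp) hd, ?_⟩
      simp only [ofC, act, subst, comb, scale]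
      ext <;> simp only <;> field_simp <;> first | ring1 | linear_combination hH

theorem rel_normal_form {q : Coeffs F} (h2 : (2 : F) ≠ 0) (hr : q.res ≠ 0) :
    (∃ s t, Rel q (ofA s t)) ∨ (∃ k b, k ≠ 0 ∧ k ≠ -1 / 2 ∧ b ≠ 0 ∧ Rel q (ofB k b)) ∨
      ∃ d k, d ≠ 0 ∧ k ^ 2 ≠ d ∧ Rel q (ofC d k) := by
  by_cases h : 2 * q.a + q.e ≠ 0 ∨ q.b + 2 * q.f ≠ 0
  · exact (rel_ofA_or_ofB_of_divergence h2 hr h).imp_right Or.inl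
  · push Not at h
    exact Or.inr (Or.inr (rel_ofC_of_divergence h2 hr h.1 h.2))

end Coeffs

/-! ### Lowest terms and composition of rational functions. -/

theorem num_denom_of_isCoprime {p q : F[X]} (h : IsCoprime p q) (hq : q ≠ 0) :
    ∃ u : F, u ≠ 0 ∧
      (algebraMap F[X] (RatFunc F) p / algebraMap F[X] (RatFunc F) q).num = C u * p ∧
      (algebraMap F[X] (RatFunc F) p / algebraMap F[X] (RatFunc F) q).denom = C u * q := by
  set x := algebraMap F[X] (RatFunc F) p / algebraMap F[X] (RatFunc F) q with hx
  have h1 : x.num * q = p * x.denom := (RatFunc.num_mul_eq_mul_denom_iff hq).2 hx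
  have h2 : q ∣ x.denom := h.symm.dvd_of_dvd_mul_left (Dvd.intro_left _ h1)
  have h3 : x.denom ∣ q := RatFunc.denom_div_dvd p q
  obtain ⟨v, hv⟩ := (associated_of_dvd_dvd h2 h3)
  obtain ⟨u, hu, huv⟩ := Polynomial.isUnit_iff.1 v.isUnit
  have hd : x.denom = C u * q := by rw [← hv, ← huv, mul_comm]
  refine ⟨u, hu.ne_zero, ?_, hd⟩
  rw [hd] at h1
  apply mul_right_cancel₀ hq
  rw [h1]; ring

theorem ratComp_div {p q : F[X]} (h : IsCoprime p q) (hq : q ≠ 0) (g : RatFunc F) :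
    ratComp (algebraMap F[X] (RatFunc F) p / algebraMap F[X] (RatFunc F) q) g =
      p.eval₂ RatFunc.C g / q.eval₂ RatFunc.C g := by
  obtain ⟨u, hu, h1, h2⟩ := num_denom_of_isCoprime h hq
  rw [ratComp, RatFunc.eval, h1, h2, eval₂_mul, eval₂_mul, eval₂_C]
  exact mul_div_mul_left _ _ (by simpa using hu)

theorem ratComp_linear {α β γ δ : F} (hd : α * δ - β * γ ≠ 0) (g : RatFunc F) :
    ratComp ((RatFunc.C α * RatFunc.X + RatFunc.C β) / (RatFunc.C γ * RatFunc.X + RatFunc.C δ)) g =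
      (RatFunc.C α * g + RatFunc.C β) / (RatFunc.C γ * g + RatFunc.C δ) := by
  have hc : IsCoprime (C α * X + C β : F[X]) (C γ * X + C δ) := by
    refine ⟨C (-γ / (α * δ - β * γ)), C (α / (α * δ - β * γ)), ?_⟩
    have h : C (-γ / (α * δ - β * γ)) * (C α * X + C β) +
        C (α / (α * δ - β * γ)) * (C γ * X + C δ) =
        C (-γ / (α * δ - β * γ) * α + α / (α * δ - β * γ) * γ) * X +
          C (-γ / (α * δ - β * γ) * β + α / (α * δ - β * γ) * δ) := by
      simp only [map_add, map_mul]; ring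
    rw [h, show -γ / (α * δ - β * γ) * α + α / (α * δ - β * γ) * γ = 0 by ring,
      show -γ / (α * δ - β * γ) * β + α / (α * δ - β * γ) * δ = 1 by
        rw [div_mul_eq_mul_div, div_mul_eq_mul_div, ← add_div, div_eq_one_iff_eq hd]; ring]
    simp
  have hq : (C γ * X + C δ : F[X]) ≠ 0 := by
    intro h
    have h0 := congrArg (coeff · 0) h
    have h1 := congrArg (coeff · 1) h
    simp at h0 h1
    simp [h0, h1] at hd
  have := ratComp_div hc hq g
  simpa using this

/-! ### Coefficients versus rational maps: coprimality, degree, conjugacy. -/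

namespace Coeffs

/-- The numerator of the map with the given coefficients. -/
def num (q : Coeffs F) : F[X] := C q.a * X ^ 2 + C q.b * X + C q.c

/-- The denominator of the map with the given coefficients. -/
def den (q : Coeffs F) : F[X] := C q.d * X ^ 2 + C q.e * X + C q.f

/-- The rational map with the given coefficients. -/
def toRat (q : Coeffs F) : RatFunc F :=
  algebraMap F[X] (RatFunc F) q.num / algebraMap F[X] (RatFunc F) q.den

theorem isCoprime_num_den {q : Coeffs F} (hq : q.res ≠ 0) : IsCoprime q.num q.den := by
  set p := q.a * q.e - q.b * q.d with hp
  set m := q.a * q.f - q.c * q.d with hm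
  -- With `r = b f - c e`, one has `a Q - d P = p X + m` and `(d X + e) P - (a X + b) Q = -(m X +
  -- r)`; eliminating `X` leaves `m² - p r`, the resultant.
  refine ⟨C q.res⁻¹ * (-C (m * q.d) + C p * (C q.d * X + C q.e)),
    C q.res⁻¹ * (C (m * q.a) - C p * (C q.a * X + C q.b)), ?_⟩
  have h : C q.res⁻¹ * C q.res = 1 := by rw [← C_mul, inv_mul_cancel₀ hq, C_1]
  rw [← h]
  simp only [num, den, hp, hm, res, C_mul, C_sub, C_pow]
  ring

theorem den_ne_zero {q : Coeffs F} (hq : q.res ≠ 0) : q.den ≠ 0 := by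
  intro h
  have h0 := congrArg (coeff · 0) h
  have h1 := congrArg (coeff · 1) h
  have h2 := congrArg (coeff · 2) h
  simp [den, coeff_X, coeff_C] at h0 h1 h2
  apply hq
  simp [res, h0, h1, h2]

theorem num_ne_zero {q : Coeffs F} (hq : q.res ≠ 0) : q.num ≠ 0 := by
  intro h
  have h0 := congrArg (coeff · 0) h
  have h1 := congrArg (coeff · 1) h
  have h2 := congrArg (coeff · 2) h
  simp [num, coeff_X, coeff_C] at h0 h1 h2
  apply hq
  simp [res, h0, h1, h2]

theorem max_natDegree {q : Coeffs F} (hq : q.a ≠ 0 ∨ q.d ≠ 0) :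
    max q.num.natDegree q.den.natDegree = 2 := by
  have h1 : q.num.natDegree ≤ 2 := natDegree_quadratic_le
  have h2 : q.den.natDegree ≤ 2 := natDegree_quadratic_le
  rcases hq with h | h
  · have : q.num.natDegree = 2 := natDegree_quadratic h
    omega
  · have : q.den.natDegree = 2 := natDegree_quadratic h
    omega

theorem a_or_d_ne_zero {q : Coeffs F} (hq : q.res ≠ 0) : q.a ≠ 0 ∨ q.d ≠ 0 := by
  by_contra! h
  apply hq
  simp [res, h]

theorem ratDegree_toRat {q : Coeffs F} (hq : q.res ≠ 0) : ratDegree q.toRat = 2 := by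
  obtain ⟨u, hu, h1, h2⟩ := num_denom_of_isCoprime (isCoprime_num_den hq) (den_ne_zero hq)
  rw [ratDegree, toRat, h1, h2, natDegree_C_mul hu, natDegree_C_mul hu]
  exact max_natDegree (a_or_d_ne_zero hq)

/-- By coprimality each quadratic divides the opposite linear factor, and one of the quadratics has
degree exactly two. -/
theorem linear_syzygy_eq_zero {q : Coeffs F} (h : IsCoprime q.num q.den)
    (had : q.a ≠ 0 ∨ q.d ≠ 0) {u u' v v' : F}
    (huv : (C u * X + C u') * q.num = (C v * X + C v') * q.den) :
    u = 0 ∧ u' = 0 ∧ v = 0 ∧ v' = 0 := by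
  have hU : (C u * X + C u' : F[X]).natDegree < 2 :=
    lt_of_le_of_lt natDegree_linear_le one_lt_two
  have hV : (C v * X + C v' : F[X]).natDegree < 2 :=
    lt_of_le_of_lt natDegree_linear_le one_lt_two
  have h1 : q.den ∣ C u * X + C u' := h.symm.dvd_of_dvd_mul_right (Dvd.intro_left _ huv.symm)
  have h2 : q.num ∣ C v * X + C v' := h.dvd_of_dvd_mul_right (Dvd.intro_left _ huv)
  have h3 : (C u * X + C u' : F[X]) = 0 ∧ (C v * X + C v' : F[X]) = 0 := by
    rcases had with ha | hd
    · have hn : q.num.natDegree = 2 := natDegree_quadratic ha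
      have hV0 := eq_zero_of_dvd_of_natDegree_lt h2 (by omega)
      rw [hV0, zero_mul] at huv
      refine ⟨(mul_eq_zero.1 huv).resolve_right ?_, hV0⟩
      intro h; simp [h] at hn
    · have hn : q.den.natDegree = 2 := natDegree_quadratic hd
      have hU0 := eq_zero_of_dvd_of_natDegree_lt h1 (by omega)
      rw [hU0, zero_mul] at huv
      refine ⟨hU0, (mul_eq_zero.1 huv.symm).resolve_right ?_⟩
      intro h; simp [h] at hn
  have e0 := congrArg (coeff · 0) h3.1
  have e1 := congrArg (coeff · 1) h3.1
  have e2 := congrArg (coeff · 0) h3.2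
  have e3 := congrArg (coeff · 1) h3.2
  simp at e0 e1 e2 e3
  exact ⟨e1, e0, e3, e2⟩

theorem syzygy_of_sq_eq {R : Type*} [CommRing R] {a b c d e f p m r : R} (hp : p = a * e - b * d)
    (hm : m = a * f - c * d) (hr : r = b * f - c * e) (h : m * m = p * r) (x : R) :
    (m * d * x + p * f) * (a * x ^ 2 + b * x + c) = (m * a * x + p * c) * (d * x ^ 2 + e * x + f) ∧
    (r * d * x + m * f) * (a * x ^ 2 + b * x + c) =
      (r * a * x + m * c) * (d * x ^ 2 + e * x + f) := by
  subst hp hm hr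
  constructor
  · linear_combination (-x) * h
  · linear_combination x ^ 2 * h

/-- A vanishing resultant, `m² = p r`, produces linear syzygies, which must be trivial. Then `m =
0`, and either the two quadratics are proportional or both vanish at `0`. -/
theorem res_ne_zero_of_isCoprime {q : Coeffs F} (h : IsCoprime q.num q.den)
    (had : q.a ≠ 0 ∨ q.d ≠ 0) : q.res ≠ 0 := by
  intro hres
  set p := q.a * q.e - q.b * q.d with hp
  set m := q.a * q.f - q.c * q.d with hm
  set r := q.b * q.f - q.c * q.e with hr
  have hres' : m * m = p * r := by
    simp only [res] at hres
    linear_combination hres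
  have hC := syzygy_of_sq_eq (a := C q.a) (b := C q.b) (c := C q.c) (d := C q.d) (e := C q.e)
    (f := C q.f) (p := C p) (m := C m) (r := C r) (by rw [hp]; simp) (by rw [hm]; simp)
    (by rw [hr]; simp) (by rw [← C_mul, ← C_mul, hres']) (X : F[X])
  obtain ⟨h1, h2, h3, h4⟩ := linear_syzygy_eq_zero h had (u := m * q.d) (u' := p * q.f)
    (v := m * q.a) (v' := p * q.c) (by simpa only [C_mul, num, den] using hC.1)
  have hm0 : m = 0 := by
    rcases had with h | h
    · exact (mul_eq_zero.1 h3).resolve_right h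
    · exact (mul_eq_zero.1 h1).resolve_right h
  obtain ⟨h5, -, h7, -⟩ := linear_syzygy_eq_zero h had (u := r * q.d) (u' := m * q.f)
    (v := r * q.a) (v' := m * q.c) (by simpa only [C_mul, num, den] using hC.2)
  by_cases hp0 : p = 0
  · obtain ⟨-, hd, -, ha⟩ := linear_syzygy_eq_zero h had (u := 0) (u' := q.d) (v := 0)
        (v' := q.a) (by
      have hpC : (C q.a * C q.e - C q.b * C q.d : F[X]) = 0 := by
        rw [← C_mul, ← C_mul, ← C_sub, ← hp, hp0, C_0]
      have hmC : (C q.a * C q.f - C q.c * C q.d : F[X]) = 0 := by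
        rw [← C_mul, ← C_mul, ← C_sub, ← hm, hm0, C_0]
      simp only [num, den, C_0, zero_mul, zero_add]
      linear_combination (-X) * hpC - hmC)
    exact had.elim (· ha) (· hd)
  · have hf := (mul_eq_zero.1 h2).resolve_left hp0
    have hc := (mul_eq_zero.1 h4).resolve_left hp0
    obtain ⟨u, v, huv⟩ := h
    have := congrArg (eval 0) huv
    simp [num, den, hf, hc] at this

theorem exists_toRat_of_ratDegree {ψ : RatFunc F} (h : ratDegree ψ = 2) :
    ∃ q : Coeffs F, q.res ≠ 0 ∧ ψ = q.toRat := by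
  have hn : ψ.num.natDegree ≤ 2 := h ▸ le_max_left _ _
  have hd : ψ.denom.natDegree ≤ 2 := h ▸ le_max_right _ _
  let q : Coeffs F := ⟨ψ.num.coeff 2, ψ.num.coeff 1, ψ.num.coeff 0, ψ.denom.coeff 2,
    ψ.denom.coeff 1, ψ.denom.coeff 0⟩
  have h1 : q.num = ψ.num := (eq_quadratic_of_degree_le_two (natDegree_le_iff_degree_le.1 hn)).symm
  have h2 : q.den = ψ.denom :=
    (eq_quadratic_of_degree_le_two (natDegree_le_iff_degree_le.1 hd)).symm
  refine ⟨q, res_ne_zero_of_isCoprime ?_ ?_, ?_⟩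
  · rw [h1, h2]; exact ψ.isCoprime_num_denom
  · by_contra! h0
    rw [ratDegree] at h
    rcases le_total ψ.num.natDegree ψ.denom.natDegree with hle | hle
    · rw [max_eq_right hle] at h
      have h3 : ψ.denom.leadingCoeff = 0 := by rw [leadingCoeff, h]; exact h0.2
      rw [leadingCoeff_eq_zero] at h3
      simp [h3] at h
    · rw [max_eq_left hle] at h
      have h3 : ψ.num.leadingCoeff = 0 := by rw [leadingCoeff, h]; exact h0.1
      rw [leadingCoeff_eq_zero] at h3
      rw [h3] at h
      simp at h
  · rw [toRat, h1, h2, ψ.num_div_denom]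

theorem num_scale (w : F) (q : Coeffs F) : (q.scale w).num = C w * q.num := by
  simp only [num, scale, C_mul]; ring

theorem den_scale (w : F) (q : Coeffs F) : (q.scale w).den = C w * q.den := by
  simp only [den, scale, C_mul]; ring

theorem toRat_scale {w : F} (hw : w ≠ 0) (q : Coeffs F) : (q.scale w).toRat = q.toRat := by
  rw [toRat, toRat, num_scale, den_scale, map_mul, map_mul]
  exact mul_div_mul_left _ _ (by simpa using hw)

theorem ext_of_num_den {q q' : Coeffs F} (h : q.num = q'.num) (h' : q.den = q'.den) : q = q' := by
  have h0 := congrArg (coeff · 0) h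
  have h1 := congrArg (coeff · 1) h
  have h2 := congrArg (coeff · 2) h
  have h0' := congrArg (coeff · 0) h'
  have h1' := congrArg (coeff · 1) h'
  have h2' := congrArg (coeff · 2) h'
  simp [num, den, coeff_X, coeff_C] at h0 h1 h2 h0' h1' h2'
  ext <;> assumption

/-- Coprimality for `q` alone makes `q'` a common polynomial multiple of it; the degree bound two,
attained by `q`, makes the cofactor constant. -/
theorem eq_scale_of_toRat_eq {q q' : Coeffs F} (hq : q.res ≠ 0) (h : q.toRat = q'.toRat) :
    ∃ w, w ≠ 0 ∧ q' = q.scale w := by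
  have hn := num_ne_zero hq
  have hd := den_ne_zero hq
  have hd' : q'.den ≠ 0 := by
    intro h0
    rw [toRat, toRat, h0, map_zero, div_zero, div_eq_zero_iff] at h
    exact h.elim (RatFunc.algebraMap_ne_zero hn) (RatFunc.algebraMap_ne_zero hd)
  rw [toRat, toRat, div_eq_div_iff (RatFunc.algebraMap_ne_zero hd)
    (RatFunc.algebraMap_ne_zero hd'), ← map_mul, ← map_mul] at h
  have h := RatFunc.algebraMap_injective F h
  obtain ⟨g, hg⟩ : q.den ∣ q'.den :=
    (isCoprime_num_den hq).symm.dvd_of_dvd_mul_left (Dvd.intro_left _ h.symm)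
  have hg' : q'.num = q.num * g := by
    rw [hg] at h
    apply mul_right_cancel₀ hd
    rw [← h]; ring
  have hg0 : g ≠ 0 := by rintro rfl; simp at hg; exact hd' hg
  have hdeg := max_natDegree (a_or_d_ne_zero hq)
  have h1 : q'.num.natDegree ≤ 2 := natDegree_quadratic_le
  have h2 : q'.den.natDegree ≤ 2 := natDegree_quadratic_le
  rw [hg', natDegree_mul hn hg0] at h1
  rw [hg, natDegree_mul hd hg0] at h2
  obtain ⟨w, rfl⟩ := natDegree_eq_zero.1 (show g.natDegree = 0 by omega)
  refine ⟨w, by simpa using hg0, ext_of_num_den ?_ ?_⟩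
  · rw [num_scale, hg', mul_comm]
  · rw [den_scale, hg, mul_comm]

theorem quadratic_div {E : Type*} [Field E] (a b c x : E) {y : E} (hy : y ≠ 0) :
    a * (x / y) ^ 2 + b * (x / y) + c = (a * x ^ 2 + b * x * y + c * y ^ 2) / y ^ 2 := by
  field_simp

theorem conjBy_toRat {q : Coeffs F} (hq : q.res ≠ 0) (h : GL (Fin 2) F) :
    conjBy h q.toRat = (q.act (h 0 0) (h 0 1) (h 1 0) (h 1 1)).toRat := by
  have hdet : h 0 0 * h 1 1 - h 0 1 * h 1 0 ≠ 0 := by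
    have := h.det_ne_zero
    rwa [Matrix.det_fin_two] at this
  have hinv : ((h⁻¹ : GL (Fin 2) F) : Matrix (Fin 2) (Fin 2) F) =
      (h 0 0 * h 1 1 - h 0 1 * h 1 0)⁻¹ • !![h 1 1, -h 0 1; -h 1 0, h 0 0] := by
    rw [Matrix.coe_units_inv, Matrix.inv_def, Matrix.adjugate_fin_two, Matrix.det_fin_two,
      Ring.inverse_eq_inv']
  generalize hα : (h 0 0 : F) = α at *
  generalize hβ : (h 0 1 : F) = β at *
  generalize hγ : (h 1 0 : F) = γ at *
  generalize hδ : (h 1 1 : F) = δ at *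
  set Δ := α * δ - β * γ with hΔ
  have hs : (q.subst α β γ δ).res ≠ 0 := by
    rw [res_subst]; exact mul_ne_zero (pow_ne_zero _ hdet) hq
  have hlin : (RatFunc.C γ * RatFunc.X + RatFunc.C δ : RatFunc F) ≠ 0 := by
    intro h0
    have h0 : algebraMap F[X] (RatFunc F) (C γ * X + C δ) = 0 := by simpa using h0
    have h1 := RatFunc.algebraMap_injective F (h0.trans (map_zero _).symm)
    have e0 := congrArg (coeff · 0) h1
    have e1 := congrArg (coeff · 1) h1
    simp at e0 e1
    simp [hΔ, e0, e1] at hdet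
  have h1 : ratComp q.toRat (mobius h) = (q.subst α β γ δ).toRat := by
    rw [toRat, ratComp_div (isCoprime_num_den hq) (den_ne_zero hq), mobius, hα, hβ, hγ, hδ, toRat]
    have e1 : q.num.eval₂ RatFunc.C ((RatFunc.C α * RatFunc.X + RatFunc.C β) /
        (RatFunc.C γ * RatFunc.X + RatFunc.C δ)) =
        algebraMap F[X] (RatFunc F) (q.subst α β γ δ).num /
          (RatFunc.C γ * RatFunc.X + RatFunc.C δ) ^ 2 := by
      simp only [num, subst, eval₂_add, eval₂_mul, eval₂_C, eval₂_X, eval₂_pow, map_add, map_mul,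
        map_pow, RatFunc.algebraMap_C, RatFunc.algebraMap_X, map_ofNat]
      rw [quadratic_div _ _ _ _ hlin]
      congr 1
      ring
    have e2 : q.den.eval₂ RatFunc.C ((RatFunc.C α * RatFunc.X + RatFunc.C β) /
        (RatFunc.C γ * RatFunc.X + RatFunc.C δ)) =
        algebraMap F[X] (RatFunc F) (q.subst α β γ δ).den /
          (RatFunc.C γ * RatFunc.X + RatFunc.C δ) ^ 2 := by
      simp only [den, subst, eval₂_add, eval₂_mul, eval₂_C, eval₂_X, eval₂_pow, map_add, map_mul,
        map_pow, RatFunc.algebraMap_C, RatFunc.algebraMap_X, map_ofNat]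
      rw [quadratic_div _ _ _ _ hlin]
      congr 1
      ring
    rw [e1, e2]
    exact div_div_div_cancel_right₀ (pow_ne_zero _ hlin) _ _
  have hden := RatFunc.algebraMap_ne_zero (den_ne_zero hs)
  have hC : (RatFunc.C Δ : RatFunc F) ≠ 0 := by simpa using hdet
  -- The inverse is `Δ⁻¹` times the adjugate used in `act`; the factor `Δ⁻¹` cancels between
  -- numerator and denominator.
  rw [conjBy, h1, mobius, hinv]
  simp only [Matrix.smul_apply, Matrix.of_apply, Matrix.cons_val', Matrix.cons_val_zero,
    Matrix.cons_val_one, Matrix.cons_val_fin_one, smul_eq_mul]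
  rw [ratComp_linear (by
    have : Δ⁻¹ * δ * (Δ⁻¹ * α) - Δ⁻¹ * -β * (Δ⁻¹ * -γ) = Δ⁻¹ := by
      field_simp; rw [hΔ]; ring
    rw [this]; exact inv_ne_zero hdet)]
  rw [act, toRat, toRat]
  have e3 : (comb δ (-β) (-γ) α (q.subst α β γ δ)).num =
      C δ * (q.subst α β γ δ).num - C β * (q.subst α β γ δ).den := by
    simp only [comb, num, den, map_add, map_mul, map_neg]; ring
  have e4 : (comb δ (-β) (-γ) α (q.subst α β γ δ)).den =
      -C γ * (q.subst α β γ δ).num + C α * (q.subst α β γ δ).den := by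
    simp only [comb, num, den, map_add, map_mul, map_neg]; ring
  rw [e3, e4]
  generalize (q.subst α β γ δ).num = P at *
  generalize (q.subst α β γ δ).den = Q at *
  simp only [map_add, map_sub, map_neg, map_mul, map_inv₀, RatFunc.algebraMap_C]
  generalize algebraMap F[X] (RatFunc F) P = p at *
  generalize algebraMap F[X] (RatFunc F) Q = r at *
  have e5 : (RatFunc.C Δ)⁻¹ * RatFunc.C δ * (p / r) + (RatFunc.C Δ)⁻¹ * -RatFunc.C β =
      (RatFunc.C δ * p - RatFunc.C β * r) / (RatFunc.C Δ * r) := by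
    field_simp; ring
  have e6 : (RatFunc.C Δ)⁻¹ * -RatFunc.C γ * (p / r) + (RatFunc.C Δ)⁻¹ * RatFunc.C α =
      (-RatFunc.C γ * p + RatFunc.C α * r) / (RatFunc.C Δ * r) := by
    field_simp
  rw [e5, e6]
  exact div_div_div_cancel_right₀ (mul_ne_zero hC hden) _ _

theorem isConj_toRat_iff {q q' : Coeffs F} (hq : q.res ≠ 0) :
    IsConj q.toRat q'.toRat ↔ Rel q q' := by
  constructor
  · rintro ⟨h, hh⟩
    rw [conjBy_toRat hq] at hh
    have hdet : h 0 0 * h 1 1 - h 0 1 * h 1 0 ≠ 0 := by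
      have := h.det_ne_zero
      rwa [Matrix.det_fin_two] at this
    obtain ⟨w, hw, e⟩ := eq_scale_of_toRat_eq (res_act_ne_zero hdet hq) hh
    exact ⟨_, _, _, _, w, hdet, hw, e⟩
  · rintro ⟨α, β, γ, δ, w, hd, hw, rfl⟩
    refine ⟨Matrix.GeneralLinearGroup.mkOfDetNeZero !![α, β; γ, δ] ?_, ?_⟩
    · rwa [Matrix.det_fin_two_of]
    · rw [conjBy_toRat hq, toRat_scale hw]
      rfl

/-! ### Base change, and the normal forms as rational functions. -/

/-- Change of the field of coefficients. -/
def map {E : Type*} [Field E] (i : F →+* E) (q : Coeffs F) : Coeffs E :=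
  ⟨i q.a, i q.b, i q.c, i q.d, i q.e, i q.f⟩

theorem res_map {E : Type*} [Field E] (i : F →+* E) (q : Coeffs F) :
    (q.map i).res = i q.res := by
  simp only [res, map, map_sub, map_mul, map_pow]

theorem res_map_ne_zero {E : Type*} [Field E] (i : F →+* E) {q : Coeffs F} (hq : q.res ≠ 0) :
    (q.map i).res ≠ 0 := by
  rw [res_map]; exact (map_ne_zero i).2 hq

theorem Rel.map {E : Type*} [Field E] (i : F →+* E) {q q' : Coeffs F} (h : Rel q q') :
    Rel (q.map i) (q'.map i) := by
  obtain ⟨α, β, γ, δ, w, hd, hw, rfl⟩ := h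
  refine ⟨i α, i β, i γ, i δ, i w, ?_, (map_ne_zero i).2 hw, ?_⟩
  · rw [← map_mul, ← map_mul, ← map_sub]; exact (map_ne_zero i).2 hd
  · simp only [Coeffs.map, act, subst, comb, scale]
    ext <;> simp [map_ofNat i 2]

theorem toBar_toRat (q : Coeffs F) :
    toBar q.toRat = (q.map (algebraMap F (AlgebraicClosure F))).toRat := by
  rw [toBar, toRat, RatFunc.coe_mapRingHom_eq_coe_map, RatFunc.map_apply_div]
  simp [toRat, num, den, map]

theorem toRat_ofA (s t : F) : (ofA s t).toRat = formA s t := by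
  simp [toRat, formA, ofA, num, den, map_ofNat RatFunc.C 2]

theorem toRat_ofB (k b : F) : (ofB k b).toRat = formB k b := by
  have := RatFunc.X_ne_zero (K := F)
  simp [toRat, formB, ofB, num, den]
  field_simp

theorem toRat_ofC (d k : F) : (ofC d k).toRat = formC d k := by
  simp [toRat, formC, ofC, num, den, sub_eq_add_neg]

theorem res_ofB_ne_zero {k b : F} (hk : k ≠ 0) (hb : b ≠ 0) : (ofB k b).res ≠ 0 := by
  simp [ofB, res, hk, hb]

theorem res_ofC (d k : F) : (ofC d k).res = 4 * d * (d - k ^ 2) ^ 2 := by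
  simp only [ofC, res]; ring

theorem res_ofC_ne_zero {d k : F} (h2 : (2 : F) ≠ 0) (hd : d ≠ 0) (hk : k ^ 2 ≠ d) :
    (ofC d k).res ≠ 0 := by
  rw [res_ofC]
  refine mul_ne_zero (mul_ne_zero ?_ hd) (pow_ne_zero _ (sub_ne_zero.2 hk.symm))
  convert mul_ne_zero h2 h2 using 1; norm_num

/-! ### Fixed points and multipliers in homogeneous coordinates. -/

/-- The vector `(x, y)` spans a fixed point of multiplier `l`: the pair of quadratic forms maps it
to a multiple `μ (x, y)`, and their divergence at `(x, y)` is `(2 + l) μ`. -/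
def IsFixed (q : Coeffs F) (x y l : F) : Prop :=
  (x ≠ 0 ∨ y ≠ 0) ∧ ∃ μ, q.a * x ^ 2 + q.b * x * y + q.c * y ^ 2 = μ * x ∧
    q.d * x ^ 2 + q.e * x * y + q.f * y ^ 2 = μ * y ∧
    (2 * q.a + q.e) * x + (q.b + 2 * q.f) * y = (2 + l) * μ

/-- The three vectors span the fixed points, counted with multiplicity: the cubic form
`y P - x Q` is proportional to the product of the forms `yᵢ x - xᵢ y`. -/
def FixedForm (q : Coeffs F) (x₁ y₁ x₂ y₂ x₃ y₃ : F) : Prop :=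
  ∃ κ : F, κ ≠ 0 ∧ -q.d = κ * (y₁ * y₂ * y₃) ∧
    q.a - q.e = -κ * (x₁ * y₂ * y₃ + y₁ * x₂ * y₃ + y₁ * y₂ * x₃) ∧
    q.b - q.f = κ * (x₁ * x₂ * y₃ + x₁ * y₂ * x₃ + y₁ * x₂ * x₃) ∧
    q.c = -κ * (x₁ * x₂ * x₃)

/-- A listing of the multipliers of the fixed points, in homogeneous coordinates. -/
def MultList (q : Coeffs F) (l₁ l₂ l₃ : F) : Prop :=
  ∃ x₁ y₁ x₂ y₂ x₃ y₃ : F, q.FixedForm x₁ y₁ x₂ y₂ x₃ y₃ ∧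
    q.IsFixed x₁ y₁ l₁ ∧ q.IsFixed x₂ y₂ l₂ ∧ q.IsFixed x₃ y₃ l₃

theorem IsFixed.scale {q : Coeffs F} {x y l : F} (h : q.IsFixed x y l) (w : F) :
    (q.scale w).IsFixed x y l := by
  obtain ⟨hv, μ, h1, h2, h3⟩ := h
  refine ⟨hv, w * μ, ?_, ?_, ?_⟩ <;> simp only [Coeffs.scale]
  · linear_combination w * h1
  · linear_combination w * h2
  · linear_combination w * h3

theorem IsFixed.act {q : Coeffs F} {x y l α β γ δ : F} (h : q.IsFixed x y l)
    (hd : α * δ - β * γ ≠ 0) :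
    (q.act α β γ δ).IsFixed (δ * x - β * y) (-γ * x + α * y) l := by
  obtain ⟨hv, μ, h1, h2, h3⟩ := h
  refine ⟨?_, (α * δ - β * γ) ^ 2 * μ, ?_, ?_, ?_⟩
  · by_contra! h0
    have e1 : (α * δ - β * γ) * x = 0 := by linear_combination α * h0.1 + β * h0.2
    have e2 : (α * δ - β * γ) * y = 0 := by linear_combination γ * h0.1 + δ * h0.2
    exact hv.elim (· ((mul_eq_zero.1 e1).resolve_left hd))
      (· ((mul_eq_zero.1 e2).resolve_left hd))
  · simp only [Coeffs.act, subst, comb]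
    linear_combination (α * δ - β * γ) ^ 2 * (δ * h1 - β * h2)
  · simp only [Coeffs.act, subst, comb]
    linear_combination (α * δ - β * γ) ^ 2 * (-γ * h1 + α * h2)
  · simp only [Coeffs.act, subst, comb]
    linear_combination (α * δ - β * γ) ^ 2 * h3

theorem FixedForm.scale {q : Coeffs F} {x₁ y₁ x₂ y₂ x₃ y₃ : F}
    (h : q.FixedForm x₁ y₁ x₂ y₂ x₃ y₃) {w : F} (hw : w ≠ 0) :
    (q.scale w).FixedForm x₁ y₁ x₂ y₂ x₃ y₃ := by
  obtain ⟨κ, hκ, h1, h2, h3, h4⟩ := h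
  refine ⟨w * κ, mul_ne_zero hw hκ, ?_, ?_, ?_, ?_⟩ <;> simp only [Coeffs.scale]
  · linear_combination w * h1
  · linear_combination w * h2
  · linear_combination w * h3
  · linear_combination w * h4

theorem FixedForm.act {q : Coeffs F} {x₁ y₁ x₂ y₂ x₃ y₃ : F}
    (h : q.FixedForm x₁ y₁ x₂ y₂ x₃ y₃) (α β γ δ : F) :
    (q.act α β γ δ).FixedForm (δ * x₁ - β * y₁) (-γ * x₁ + α * y₁) (δ * x₂ - β * y₂)
      (-γ * x₂ + α * y₂) (δ * x₃ - β * y₃) (-γ * x₃ + α * y₃) := by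
  obtain ⟨κ, hκ, h1, h2, h3, h4⟩ := h
  refine ⟨κ, hκ, ?_, ?_, ?_, ?_⟩ <;> simp only [Coeffs.act, subst, comb]
  · linear_combination α ^ 3 * h1 + α ^ 2 * γ * h2 + α * γ ^ 2 * h3 + γ ^ 3 * h4
  · linear_combination 3 * α ^ 2 * β * h1 + (α ^ 2 * δ + 2 * α * β * γ) * h2 +
      (β * γ ^ 2 + 2 * α * γ * δ) * h3 + 3 * γ ^ 2 * δ * h4
  · linear_combination 3 * α * β ^ 2 * h1 + (β ^ 2 * γ + 2 * α * β * δ) * h2 +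
      (α * δ ^ 2 + 2 * β * γ * δ) * h3 + 3 * γ * δ ^ 2 * h4
  · linear_combination β ^ 3 * h1 + β ^ 2 * δ * h2 + β * δ ^ 2 * h3 + δ ^ 3 * h4

theorem MultList.of_rel {q q' : Coeffs F} {l₁ l₂ l₃ : F} (h : q.MultList l₁ l₂ l₃)
    (hq : Rel q q') : q'.MultList l₁ l₂ l₃ := by
  obtain ⟨x₁, y₁, x₂, y₂, x₃, y₃, hF, h1, h2, h3⟩ := h
  obtain ⟨α, β, γ, δ, w, hd, hw, rfl⟩ := hq
  exact ⟨_, _, _, _, _, _, (hF.act α β γ δ).scale hw, (h1.act hd).scale w, (h2.act hd).scale w,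
    (h3.act hd).scale w⟩

/-- If `μ = 0`, the two forms have a common zero, and elimination gives `res * x ^ 3 = res * y ^ 3 =
0`. -/
theorem IsFixed.denom_ne_zero {q : Coeffs F} (hq : q.res ≠ 0) {x y μ : F} (hv : x ≠ 0 ∨ y ≠ 0)
    (h1 : q.a * x ^ 2 + q.b * x * y + q.c * y ^ 2 = μ * x)
    (h2 : q.d * x ^ 2 + q.e * x * y + q.f * y ^ 2 = μ * y) : μ ≠ 0 := by
  rintro rfl
  have hy : q.res * y ^ 3 = 0 := by
    simp only [res]
    linear_combination (q.a * q.f - q.c * q.d) * y * (q.a * h2 - q.d * h1) -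
      (q.a * q.e - q.b * q.d) * (x * (q.a * h2 - q.d * h1) - y * (q.e * h1 - q.b * h2))
  have hx : q.res * x ^ 3 = 0 := by
    simp only [res]
    linear_combination (q.a * q.f - q.c * q.d) * x * (q.f * h1 - q.c * h2) -
      (q.b * q.f - q.c * q.e) * (x * (q.e * h1 - q.b * h2) + y * (q.f * h1 - q.c * h2))
  simp [hq] at hx hy
  simp [hx, hy] at hv

/-- At `(z, 1)` Euler's identity reads `∂Q/∂y = 2 Q - z Q'`, so the divergence condition says `P' -
z Q' = l Q`, which is the derivative formula at a fixed point. -/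
theorem derivAt_toRat {q : Coeffs F} (hq : q.res ≠ 0) {x y l : F} (hy : y ≠ 0)
    (h : q.IsFixed x y l) : derivAt q.toRat (x / y) = l := by
  obtain ⟨hv, μ, h1, h2, h3⟩ := h
  have hμ := IsFixed.denom_ne_zero hq hv h1 h2
  obtain ⟨u, hu, e1, e2⟩ := num_denom_of_isCoprime (isCoprime_num_den hq) (den_ne_zero hq)
  obtain ⟨z, rfl⟩ : ∃ z, x = z * y := ⟨x / y, by field_simp⟩
  obtain ⟨t, rfl⟩ : ∃ t, μ = t * y := ⟨μ / y, by field_simp⟩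
  have ht : t ≠ 0 := left_ne_zero_of_mul hμ
  have h1 : q.a * z ^ 2 + q.b * z + q.c = t * z := by
    apply mul_left_cancel₀ (pow_ne_zero 2 hy); linear_combination h1
  have h2 : q.d * z ^ 2 + q.e * z + q.f = t := by
    apply mul_left_cancel₀ (pow_ne_zero 2 hy); linear_combination h2
  have h3 : (2 * q.a + q.e) * z + (q.b + 2 * q.f) = (2 + l) * t := by
    apply mul_left_cancel₀ hy; linear_combination h3
  rw [mul_div_cancel_right₀ _ hy, derivAt, toRat, e1, e2]
  simp only [num, den, derivative_mul, derivative_C, derivative_add, derivative_X_pow,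
    derivative_X, eval_add, eval_mul, eval_sub, eval_C, eval_X, eval_pow, zero_mul, zero_add,
    mul_one, add_zero, Nat.cast_ofNat, Nat.add_one_sub_one, pow_one]
  rw [h1, h2, div_eq_iff (pow_ne_zero _ (mul_ne_zero hu ht))]
  linear_combination u ^ 2 * t * (h3 - 2 * h2)

/-- Exchange of `0` and `∞`. -/
def swap (q : Coeffs F) : Coeffs F := ⟨q.f, q.e, q.d, q.c, q.b, q.a⟩

theorem res_swap (q : Coeffs F) : q.swap.res = q.res := by
  simp only [res, swap]; ring

theorem IsFixed.swap {q : Coeffs F} {x y l : F} (h : q.IsFixed x y l) : q.swap.IsFixed y x l := by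
  obtain ⟨hv, μ, h1, h2, h3⟩ := h
  refine ⟨hv.symm, μ, ?_, ?_, ?_⟩ <;> simp only [Coeffs.swap]
  · linear_combination h2
  · linear_combination h1
  · linear_combination h3

theorem FixedForm.swap {q : Coeffs F} {x₁ y₁ x₂ y₂ x₃ y₃ : F}
    (h : q.FixedForm x₁ y₁ x₂ y₂ x₃ y₃) : q.swap.FixedForm y₁ x₁ y₂ x₂ y₃ x₃ := by
  obtain ⟨κ, hκ, h1, h2, h3, h4⟩ := h
  refine ⟨κ, hκ, ?_, ?_, ?_, ?_⟩ <;> simp only [Coeffs.swap]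
  · linear_combination -h4
  · linear_combination -h3
  · linear_combination -h2
  · linear_combination -h1

theorem atInfty_toRat {q : Coeffs F} (hq : q.res ≠ 0) : atInfty q.toRat = q.swap.toRat := by
  have hX := RatFunc.X_ne_zero (K := F)
  rw [atInfty, toRat, ratComp_div (isCoprime_num_den hq) (den_ne_zero hq), toRat, inv_div]
  have e (a b c : F) : RatFunc.C a * (RatFunc.X⁻¹) ^ 2 + RatFunc.C b * RatFunc.X⁻¹ + RatFunc.C c =
      (RatFunc.C c * RatFunc.X ^ 2 + RatFunc.C b * RatFunc.X + RatFunc.C a) / RatFunc.X ^ 2 := by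
    field_simp; ring
  simp only [num, den, swap, eval₂_add, eval₂_mul, eval₂_C, eval₂_X, eval₂_pow, map_add, map_mul,
    map_pow, RatFunc.algebraMap_C, RatFunc.algebraMap_X, e]
  exact div_div_div_cancel_right₀ (pow_ne_zero _ hX) _ _

theorem fixedPoly_toRat {q : Coeffs F} (hq : q.res ≠ 0) {x₁ y₁ x₂ y₂ x₃ y₃ : F}
    (h : q.FixedForm x₁ y₁ x₂ y₂ x₃ y₃) : ∃ w, w ≠ 0 ∧ fixedPoly q.toRat =
      C w * ((C y₁ * X - C x₁) * (C y₂ * X - C x₂) * (C y₃ * X - C x₃)) := by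
  obtain ⟨u, hu, e1, e2⟩ := num_denom_of_isCoprime (isCoprime_num_den hq) (den_ne_zero hq)
  obtain ⟨κ, hκ, h1, h2, h3, h4⟩ := h
  refine ⟨u * κ, mul_ne_zero hu hκ, ?_⟩
  rw [fixedPoly, toRat, e1, e2]
  have h1 := congrArg (C : F → F[X]) h1
  have h2 := congrArg (C : F → F[X]) h2
  have h3 := congrArg (C : F → F[X]) h3
  have h4 := congrArg (C : F → F[X]) h4
  simp only [map_mul, map_sub, map_add, map_neg] at h1 h2 h3 h4
  simp only [num, den, map_mul]
  linear_combination C u * (X ^ 3 * h1 + X ^ 2 * h2 + X * h3 + h4)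

theorem roots_linear [DecidableEq F] (x y : F) :
    (C y * X - C x : F[X]).roots = if y = 0 then 0 else {x / y} := by
  split_ifs with h
  · rw [h, C_0, zero_mul, zero_sub, ← C_neg, roots_C]
  · rw [roots_C_mul_X_sub_C x h, div_eq_inv_mul]

theorem linear_ne_zero {x y : F} (h : x ≠ 0 ∨ y ≠ 0) : (C y * X - C x : F[X]) ≠ 0 := by
  intro h0
  have e0 := congrArg (coeff · 0) h0
  have e1 := congrArg (coeff · 1) h0
  simp at e0 e1
  simp [e0, e1] at h

theorem count_roots_linear [DecidableEq F] {x y : F} (h : x ≠ 0 ∨ y ≠ 0) :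
    (C y * X - C x : F[X]).rootMultiplicity 0 = if x = 0 then 1 else 0 := by
  rw [← count_roots, roots_linear]
  by_cases hy : y = 0
  · simp [hy] at h
    simp [hy, h]
  · simp only [hy, if_false, Multiset.count_singleton, eq_comm (a := (0 : F)), div_eq_zero_iff,
      or_false]

theorem MultList.multipliers_eq {q : Coeffs F} (hq : q.res ≠ 0) {l₁ l₂ l₃ : F}
    (h : q.MultList l₁ l₂ l₃) : multipliers q.toRat = {l₁, l₂, l₃} := by
  classical
  obtain ⟨x₁, y₁, x₂, y₂, x₃, y₃, hF, h1, h2, h3⟩ := h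
  have hq' : q.swap.res ≠ 0 := by rwa [res_swap]
  obtain ⟨w, hw, e⟩ := fixedPoly_toRat hq hF
  obtain ⟨w', hw', e'⟩ := fixedPoly_toRat hq' hF.swap
  have n1 := linear_ne_zero h1.1
  have n2 := linear_ne_zero h2.1
  have n3 := linear_ne_zero h3.1
  have m1 := linear_ne_zero h1.1.symm
  have m2 := linear_ne_zero h2.1.symm
  have m3 := linear_ne_zero h3.1.symm
  -- Each fixed vector contributes exactly one multiplier, through a finite root or through
  -- infinity, so the three contributions simply add up.
  have key : ∀ x y l : F, q.IsFixed x y l →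
      (C y * X - C x : F[X]).roots.map (derivAt q.toRat) +
        Multiset.replicate ((C x * X - C y : F[X]).rootMultiplicity 0)
          (derivAt q.swap.toRat 0) = {l} := by
    intro x y l h
    rw [roots_linear, count_roots_linear h.1.symm]
    by_cases hy : y = 0
    · subst hy
      have hx : x ≠ 0 := by simpa using h.1
      have := derivAt_toRat hq' hx h.swap
      rw [zero_div] at this
      simp [this]
    · simp [hy, derivAt_toRat hq hy h]
  rw [multipliers, atInfty_toRat hq, e, e', roots_C_mul _ hw,
    roots_mul (mul_ne_zero (mul_ne_zero n1 n2) n3),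
    roots_mul (mul_ne_zero n1 n2), rootMultiplicity_mul, rootMultiplicity_mul,
    rootMultiplicity_mul, rootMultiplicity_C]
  rotate_left
  · exact mul_ne_zero m1 m2
  · exact mul_ne_zero (mul_ne_zero m1 m2) m3
  · exact mul_ne_zero (by simpa using hw') (mul_ne_zero (mul_ne_zero m1 m2) m3)
  rw [zero_add, Multiset.map_add, Multiset.map_add, Multiset.replicate_add, Multiset.replicate_add]
  have := congrArg₂ (· + ·) (congrArg₂ (· + ·) (key _ _ _ h1) (key _ _ _ h2)) (key _ _ _ h3)
  beta_reduce at this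
  rw [show ({l₁, l₂, l₃} : Multiset F) = {l₁} + {l₂} + {l₃} from rfl, ← this]
  abel

end Coeffs

/-! ### Unordered triples and mutual exclusion of the cases. -/

theorem multiset_triple_eq {α : Type*} {l₁ l₂ l₃ m₁ m₂ m₃ : α}
    (h : ({l₁, l₂, l₃} : Multiset α) = {m₁, m₂, m₃}) :
    (l₁ = m₁ ∧ l₂ = m₂ ∧ l₃ = m₃) ∨ (l₁ = m₁ ∧ l₂ = m₃ ∧ l₃ = m₂) ∨
    (l₁ = m₂ ∧ l₂ = m₁ ∧ l₃ = m₃) ∨ (l₁ = m₂ ∧ l₂ = m₃ ∧ l₃ = m₁) ∨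
    (l₁ = m₃ ∧ l₂ = m₁ ∧ l₃ = m₂) ∨ (l₁ = m₃ ∧ l₂ = m₂ ∧ l₃ = m₁) := by
  have pair : ∀ {a b c d : α}, ({a, b} : Multiset α) = {c, d} →
      (a = c ∧ b = d) ∨ (a = d ∧ b = c) := by
    intro a b c d h
    have := Multiset.cons_eq_cons.1 h
    rcases this with ⟨h1, h2⟩ | ⟨-, cs, h1, h2⟩
    · exact Or.inl ⟨h1, by simpa using h2⟩
    · have e1 := Multiset.singleton_eq_cons_iff _ |>.1 h1
      have e2 := Multiset.singleton_eq_cons_iff _ |>.1 h2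
      exact Or.inr ⟨e2.1.symm, e1.1⟩
  have hmem : l₁ ∈ ({m₁, m₂, m₃} : Multiset α) := h ▸ Multiset.mem_cons_self _ _
  simp only [Multiset.insert_eq_cons, Multiset.mem_cons, Multiset.mem_singleton] at hmem
  rcases hmem with rfl | rfl | rfl
  · rcases pair ((Multiset.cons_inj_right _).1 h) with h | h <;> simp [h]
  · have h' : ({l₁, l₂, l₃} : Multiset α) = {l₁, m₁, m₃} :=
      h.trans (Multiset.cons_swap m₁ l₁ {m₃})
    rcases pair ((Multiset.cons_inj_right _).1 h') with h | h <;> simp [h]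
  · have h' : ({l₁, l₂, l₃} : Multiset α) = {l₁, m₁, m₂} := by
      rw [h]
      simp only [Multiset.insert_eq_cons, ← Multiset.singleton_add]
      abel
    rcases pair ((Multiset.cons_inj_right _).1 h') with h | h <;> simp [h]

theorem exists_cubic_roots [IsAlgClosed F] (s t u : F) :
    ∃ l₁ l₂ l₃ : F, s = l₁ + l₂ + l₃ ∧ t = l₁ * l₂ + l₁ * l₃ + l₂ * l₃ ∧ u = l₁ * l₂ * l₃ := by
  obtain ⟨l₁, h₁⟩ := IsAlgClosed.exists_root
    (C 1 * X ^ 3 + C (-s) * X ^ 2 + C t * X + C (-u) : F[X])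
    (by rw [degree_cubic one_ne_zero]; norm_num)
  obtain ⟨l₂, h₂⟩ := IsAlgClosed.exists_root
    (C 1 * X ^ 2 + C (-(s - l₁)) * X + C (t - l₁ * (s - l₁)) : F[X])
    (by rw [degree_quadratic one_ne_zero]; norm_num)
  simp only [IsRoot, eval_add, eval_mul, eval_C, eval_pow, eval_X] at h₁ h₂
  refine ⟨l₁, l₂, s - l₁ - l₂, by ring, ?_, ?_⟩
  · linear_combination h₂
  · linear_combination -h₁ + l₁ * h₂

theorem not_condA_condB {l₁ l₂ l₃ m₁ m₂ m₃ : F}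
    (h : ({l₁, l₂, l₃} : Multiset F) = {m₁, m₂, m₃}) (hA : CondA l₁ l₂ l₃) (hB : CondB m₁ m₂ m₃) :
    False := by
  simp only [CondA, CondB] at hA hB
  rcases multiset_triple_eq h with h | h | h | h | h | h <;> obtain ⟨rfl, rfl, rfl⟩ := h <;> grind

theorem not_condA_condC {l₁ l₂ l₃ m₁ m₂ m₃ : F}
    (h : ({l₁, l₂, l₃} : Multiset F) = {m₁, m₂, m₃}) (hA : CondA l₁ l₂ l₃) (hC : CondC m₁ m₂ m₃) :
    False := by
  obtain ⟨rfl, rfl, rfl⟩ := hC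
  simp only [CondA] at hA
  rcases multiset_triple_eq h with h | h | h | h | h | h <;> obtain ⟨rfl, rfl, rfl⟩ := h <;>
    simp at hA

/-- In characteristic `3` the triples `(1, 1, 1)` and `(-2, -2, -2)` would coincide. -/
theorem not_condB_condC (h3 : (3 : F) ≠ 0) {l₁ l₂ l₃ m₁ m₂ m₃ : F}
    (h : ({l₁, l₂, l₃} : Multiset F) = {m₁, m₂, m₃}) (hB : CondB l₁ l₂ l₃) (hC : CondC m₁ m₂ m₃) :
    False := by
  have h1 : (-2 : F) ≠ 1 := by intro h; apply h3; linear_combination -h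
  obtain ⟨rfl, rfl, rfl⟩ := hC
  simp only [CondB] at hB
  rcases multiset_triple_eq h with h | h | h | h | h | h <;> obtain ⟨rfl, rfl, rfl⟩ := h <;>
    simp [h1] at hB

/-! ### Multipliers of the normal forms. -/

namespace Coeffs

/-- The fixed points are the roots of `l³ - s l² + t l - (s - 2)`, each equal to its multiplier.
Equal multipliers thus mean a multiple fixed point, hence multiplier `1`; three of them would make
the denominator vanish at `1`. -/
theorem multList_ofA [IsAlgClosed F] {s t : F} (hr : (ofA s t).res ≠ 0) :
    ∃ l₁ l₂ l₃, s = l₁ + l₂ + l₃ ∧ t = l₁ * l₂ + l₁ * l₃ + l₂ * l₃ ∧ CondA l₁ l₂ l₃ ∧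
      (ofA s t).MultList l₁ l₂ l₃ := by
  obtain ⟨l₁, l₂, l₃, hs, ht, hu⟩ := exists_cubic_roots s t (s - 2)
  have hfix : ∀ l, l ^ 3 - s * l ^ 2 + t * l + (2 - s) = 0 →
      -l ^ 2 + (2 + s) * l + (2 - s - t) ≠ 0 ∧ (ofA s t).IsFixed l 1 l := by
    intro l hl
    have h1 : (ofA s t).a * l ^ 2 + (ofA s t).b * l * 1 + (ofA s t).c * 1 ^ 2 =
        (-l ^ 2 + (2 + s) * l + (2 - s - t)) * l := by
      simp only [ofA]; linear_combination hl
    have h2 : (ofA s t).d * l ^ 2 + (ofA s t).e * l * 1 + (ofA s t).f * 1 ^ 2 =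
        (-l ^ 2 + (2 + s) * l + (2 - s - t)) * 1 := by
      simp only [ofA]; ring
    refine ⟨IsFixed.denom_ne_zero hr (Or.inr one_ne_zero) h1 h2, Or.inr one_ne_zero, _, h1, h2, ?_⟩
    simp only [ofA]
    linear_combination hl
  have r1 : l₁ ^ 3 - s * l₁ ^ 2 + t * l₁ + (2 - s) = 0 := by
    linear_combination -hu - l₁ ^ 2 * hs + l₁ * ht
  have r2 : l₂ ^ 3 - s * l₂ ^ 2 + t * l₂ + (2 - s) = 0 := by
    linear_combination -hu - l₂ ^ 2 * hs + l₂ * ht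
  have r3 : l₃ ^ 3 - s * l₃ ^ 2 + t * l₃ + (2 - s) = 0 := by
    linear_combination -hu - l₃ ^ 2 * hs + l₃ * ht
  have hdouble : ∀ l, l ^ 3 - s * l ^ 2 + t * l + (2 - s) = 0 →
      3 * l ^ 2 - 2 * s * l + t = 0 → l = 1 := by
    intro l hl hl'
    have : (l - 1) * (-l ^ 2 + (2 + s) * l + (2 - s - t)) = 0 := by linear_combination hl' - hl
    exact sub_eq_zero.1 ((mul_eq_zero.1 this).resolve_right (hfix l hl).1)
  have d12 : l₁ = l₂ → l₁ = 1 := fun h ↦ hdouble l₁ r1 (by subst h; rw [hs, ht]; ring)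
  have d13 : l₁ = l₃ → l₁ = 1 := fun h ↦ hdouble l₁ r1 (by subst h; rw [hs, ht]; ring)
  have d23 : l₂ = l₃ → l₂ = 1 := fun h ↦ hdouble l₂ r2 (by subst h; rw [hs, ht]; ring)
  have hne : ¬ (l₁ = 1 ∧ l₂ = 1 ∧ l₃ = 1) := by
    rintro ⟨rfl, rfl, rfl⟩
    apply (hfix 1 r1).1
    rw [hs, ht]; ring
  refine ⟨l₁, l₂, l₃, hs, ht, ?_, l₁, 1, l₂, 1, l₃, 1, ⟨1, one_ne_zero, ?_, ?_, ?_, ?_⟩,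
    (hfix l₁ r1).2, (hfix l₂ r2).2, (hfix l₃ r3).2⟩
  · simp only [CondA]; grind
  · simp [ofA]
  · simp only [ofA]; linear_combination -hs
  · simp only [ofA]; linear_combination ht
  · simp only [ofA]; linear_combination -hu

/-- For `k = 1` infinity is a triple fixed point; otherwise the finite fixed points are the square
roots of `b / (1 - k)`. -/
theorem multList_ofB [IsAlgClosed F] {k b : F} (hk : k ≠ 0) (hb : b ≠ 0) :
    (ofB k b).MultList (2 * k - 1) (2 * k - 1) (1 / k) := by
  have hinf : (ofB k b).IsFixed 1 0 (1 / k) := by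
    refine ⟨Or.inl one_ne_zero, k, ?_, ?_, ?_⟩ <;> simp [ofB]
    field_simp
  by_cases h1 : k = 1
  · have hinf' : (ofB k b).IsFixed 1 0 (2 * k - 1) := by
      convert hinf using 1; rw [h1]; norm_num
    exact ⟨1, 0, 1, 0, 1, 0, ⟨-b, neg_ne_zero.2 hb, by simp [ofB], by simp [ofB, h1],
      by simp [ofB], by simp [ofB]⟩, hinf', hinf', hinf⟩
  · have h1' : k - 1 ≠ 0 := sub_ne_zero.2 h1
    obtain ⟨r, hr⟩ := IsAlgClosed.exists_pow_nat_eq (-b / (k - 1)) two_pos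
    have hr' : (k - 1) * r ^ 2 = -b := by rw [hr]; field_simp
    have hfix : ∀ x, x ^ 2 = r ^ 2 → (ofB k b).IsFixed x 1 (2 * k - 1) := by
      intro x hx
      refine ⟨Or.inr one_ne_zero, x, ?_, ?_, ?_⟩ <;> simp only [ofB]
      · linear_combination hr' + (k - 1) * hx
      · ring
      · ring
    refine ⟨r, 1, -r, 1, 1, 0, ⟨1 - k, sub_ne_zero.2 (Ne.symm h1), ?_, ?_, ?_, ?_⟩, hfix _ rfl,
      hfix _ (by ring), hinf⟩ <;> simp only [ofB]
    · ring
    · ring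
    · ring
    · linear_combination hr'

theorem multList_ofC [IsAlgClosed F] (d k : F) : (ofC d k).MultList (-2) (-2) (-2) := by
  obtain ⟨l₁, l₂, l₃, hs, ht, hu⟩ := exists_cubic_roots (3 * k) (3 * d) (d * k)
  have hfix : ∀ l, l ^ 3 - 3 * k * l ^ 2 + 3 * d * l - d * k = 0 →
      (ofC d k).IsFixed l 1 (-2) := by
    intro l hl
    refine ⟨Or.inr one_ne_zero, l ^ 2 - 2 * k * l + d, ?_, ?_, ?_⟩ <;> simp only [ofC]
    · linear_combination -hl
    · ring
    · ring
  refine ⟨l₁, 1, l₂, 1, l₃, 1, ⟨-1, by simp, ?_, ?_, ?_, ?_⟩, hfix _ ?_, hfix _ ?_, hfix _ ?_⟩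
  · simp [ofC]
  · simp only [ofC]; linear_combination hs
  · simp only [ofC]; linear_combination -ht
  · simp only [ofC]; linear_combination hu
  · linear_combination -hu - l₁ ^ 2 * hs + l₁ * ht
  · linear_combination -hu - l₂ ^ 2 * hs + l₂ * ht
  · linear_combination -hu - l₃ ^ 2 * hs + l₃ * ht

theorem condB_ofB (h2 : (2 : F) ≠ 0) {k : F} (hk : k ≠ 0) (hk' : k ≠ -1 / 2) :
    CondB (2 * k - 1) (2 * k - 1) (1 / k) := by
  by_cases h1 : k = 1
  · right; subst h1; norm_num
  · left
    refine ⟨rfl, ?_, ?_⟩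
    · intro h; apply h1; apply mul_left_cancel₀ h2; linear_combination h
    · intro h
      rw [div_eq_iff hk] at h
      have : (2 * k + 1) * (k - 1) = 0 := by linear_combination -h
      rcases mul_eq_zero.1 this with h0 | h0
      · apply hk'; rw [eq_div_iff h2]; linear_combination h0
      · exact h1 (sub_eq_zero.1 h0)

/-! ### Conjugacy within each family. -/

theorem Rel.multiset_eq {q q' : Coeffs F} (hq : q.res ≠ 0) (h : Rel q q') {l₁ l₂ l₃ m₁ m₂ m₃ : F}
    (hl : q.MultList l₁ l₂ l₃) (hm : q'.MultList m₁ m₂ m₃) :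
    ({l₁, l₂, l₃} : Multiset F) = {m₁, m₂, m₃} :=
  ((hl.of_rel h).multipliers_eq (h.res_ne_zero hq)).symm.trans
    (hm.multipliers_eq (h.res_ne_zero hq))

theorem Rel.ofA_injective [IsAlgClosed F] {s t s' t' : F} (hr : (ofA s t).res ≠ 0)
    (h : Rel (ofA s t) (ofA s' t')) : s = s' ∧ t = t' := by
  obtain ⟨l₁, l₂, l₃, rfl, rfl, -, hl⟩ := multList_ofA hr
  obtain ⟨m₁, m₂, m₃, hs, ht, -, hm⟩ := multList_ofA (h.res_ne_zero hr)
  rw [hs, ht]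
  rcases multiset_triple_eq (h.multiset_eq hr hl hm) with h | h | h | h | h | h <;>
    obtain ⟨rfl, rfl, rfl⟩ := h <;> constructor <;> ring

theorem Rel.ofB_fst_eq [IsAlgClosed F] (h2 : (2 : F) ≠ 0) {k b k' b' : F} (hk : k ≠ 0) (hb : b ≠ 0)
    (hk' : k' ≠ 0) (hb' : b' ≠ 0) (h : Rel (ofB k b) (ofB k' b')) : k = k' := by
  have := h.multiset_eq (res_ofB_ne_zero hk hb) (multList_ofB hk hb) (multList_ofB hk' hb')
  apply mul_left_cancel₀ h2
  rcases multiset_triple_eq this with h | h | h | h | h | h <;> obtain ⟨h1, h3, h4⟩ := h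
  · linear_combination h1
  · linear_combination h1
  · linear_combination h1
  · linear_combination h1
  · linear_combination h3
  · linear_combination h3

/-- The divergence is `(2 k + 1) x`, nonzero because `k ≠ -1/2`. A conjugation fixes its zero `0`,
so `β = 0`, and the image infinity of `0`, so `γ = 0`; a scaling by `c` divides `b` by `c²`. -/
theorem rel_ofB_iff {k b b' : F} (h2 : (2 : F) ≠ 0) (hk : k ≠ -1 / 2) (hb : b ≠ 0) (hb' : b' ≠ 0) :
    Rel (ofB k b) (ofB k b') ↔ ∃ c : F, c ≠ 0 ∧ b / b' = c ^ 2 := by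
  constructor
  · rintro ⟨α, β, γ, δ, w, hd, hw, h⟩
    have hk2 : 2 * k + 1 ≠ 0 := by
      intro h; apply hk; rw [eq_div_iff h2]; linear_combination h
    rw [Coeffs.ext_iff] at h
    simp only [ofB, act, subst, comb, scale] at h
    obtain ⟨ha, hb1, hc, hd1, he, hf⟩ := h
    have hβ : β = 0 := by
      have : w * (α * δ - β * γ) * (2 * k + 1) * β = 0 := by linear_combination -hb1 - 2 * hf
      exact (mul_eq_zero.1 this).resolve_left (mul_ne_zero (mul_ne_zero hw hd) hk2)
    subst hβ
    have hαδ : α ≠ 0 ∧ δ ≠ 0 := by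
      refine ⟨?_, ?_⟩ <;> rintro rfl <;> simp at hd
    obtain ⟨hα, hδ⟩ := hαδ
    have hγ : γ = 0 := by
      have : w * b * δ ^ 2 * γ = 0 := by linear_combination hf
      exact (mul_eq_zero.1 this).resolve_left
        (mul_ne_zero (mul_ne_zero hw hb) (pow_ne_zero _ hδ))
    subst hγ
    refine ⟨α / δ, div_ne_zero hα hδ, ?_⟩
    rw [div_pow, div_eq_div_iff hb' (pow_ne_zero _ hδ)]
    linear_combination b * δ ^ 2 * he - α ^ 2 * hc
  · rintro ⟨c, hc, h⟩
    rw [div_eq_iff hb'] at h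
    subst h
    refine ⟨c, 0, 0, 1, 1 / c ^ 2, by simpa using hc, by simpa using hc, ?_⟩
    simp only [ofB, act, subst, comb, scale]
    ext <;> simp only <;> field_simp <;> ring

theorem rel_ofC_inv_sq [IsAlgClosed F] (h2 : (2 : F) ≠ 0) {d k : F} (hd : d ≠ 0) (hk : k ^ 2 ≠ d) :
    Rel (ofC d k) ⟨0, 0, 1, 1, 0, 0⟩ := by
  obtain ⟨e, rfl⟩ := IsAlgClosed.exists_pow_nat_eq d two_pos
  have he : e ≠ 0 := by rintro rfl; simp at hd
  have h4 : (4 : F) ≠ 0 := by convert mul_ne_zero h2 h2 using 1; norm_num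
  have hp : k + e ≠ 0 := by
    intro h; apply hk; linear_combination (k - e) * h
  have hm : e - k ≠ 0 := by
    intro h; apply hk; linear_combination (-k - e) * h
  obtain ⟨u, hu⟩ := IsAlgClosed.exists_pow_nat_eq ((k + e) / (e - k)) three_pos
  have hu0 : u ≠ 0 := by
    rintro rfl
    rw [zero_pow three_ne_zero, eq_comm, div_eq_zero_iff] at hu
    exact hu.elim hp hm
  have hu' : u ^ 3 * (e - k) = k + e := by rw [hu]; field_simp
  -- Infinity and `0` are sent to the critical points `e` and `-e`; a scaling by the cube root `u`
  -- then yields `1 / z²`.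
  have h1 : Rel (ofC (e ^ 2) k) ((ofC (e ^ 2) k).act e (-e) 1 1) := by
    apply rel_act
    intro h; apply mul_ne_zero h2 he; linear_combination h
  refine h1.trans ⟨u, 0, 0, 1, 1 / (4 * e ^ 2 * (k + e)), by simpa using hu0, ?_, ?_⟩
  · exact div_ne_zero one_ne_zero (mul_ne_zero (mul_ne_zero h4 hd) hp)
  · simp only [ofC, act, subst, comb, scale]
    ext <;> simp only <;> field_simp <;> first | ring1 | linear_combination -4 * hu'

theorem act_jacobian₀ (α β γ δ w : F) (q : Coeffs F) :
    ((q.act α β γ δ).scale w).a * ((q.act α β γ δ).scale w).e -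
        ((q.act α β γ δ).scale w).b * ((q.act α β γ δ).scale w).d =
      w ^ 2 * (α * δ - β * γ) ^ 2 * ((q.a * q.e - q.b * q.d) * α ^ 2 +
        2 * (q.a * q.f - q.c * q.d) * α * γ + (q.b * q.f - q.c * q.e) * γ ^ 2) := by
  simp only [act, subst, comb, scale]; ring

theorem act_jacobian₁ (α β γ δ w : F) (q : Coeffs F) :
    ((q.act α β γ δ).scale w).a * ((q.act α β γ δ).scale w).f -
        ((q.act α β γ δ).scale w).c * ((q.act α β γ δ).scale w).d =
      w ^ 2 * (α * δ - β * γ) ^ 2 * ((q.a * q.e - q.b * q.d) * α * β +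
        (q.a * q.f - q.c * q.d) * (α * δ + β * γ) + (q.b * q.f - q.c * q.e) * γ * δ) := by
  simp only [act, subst, comb, scale]; ring

theorem act_jacobian₂ (α β γ δ w : F) (q : Coeffs F) :
    ((q.act α β γ δ).scale w).b * ((q.act α β γ δ).scale w).f -
        ((q.act α β γ δ).scale w).c * ((q.act α β γ δ).scale w).e =
      w ^ 2 * (α * δ - β * γ) ^ 2 * ((q.a * q.e - q.b * q.d) * β ^ 2 +
        2 * (q.a * q.f - q.c * q.d) * β * δ + (q.b * q.f - q.c * q.e) * δ ^ 2) := by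
  simp only [act, subst, comb, scale]; ring

/-- The Jacobian of `ofC d k` is `2 (d - k²) (x² - d y²)`. Its covariance restricts the matrix
(`h1`) and determines `d'` (`h0`); comparing leading coefficients gives `k'`. -/
theorem Rel.ofC_params (h2 : (2 : F) ≠ 0) {d k d' k' : F} (hd : d ≠ 0) (hk : k ^ 2 ≠ d)
    (h : Rel (ofC d k) (ofC d' k')) :
    ∃ γ b : F, b ≠ 0 ∧ d' = b ^ 2 * d ∧ ((k ≠ 0 ∧ k' = b * d / k) ∨
      (d * k * γ ^ 3 + 3 * d * γ ^ 2 + 3 * k * γ + 1 ≠ 0 ∧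
        k' = b * (d ^ 2 * γ ^ 3 + 3 * d * k * γ ^ 2 + 3 * d * γ + k) /
          (d * k * γ ^ 3 + 3 * d * γ ^ 2 + 3 * k * γ + 1))) := by
  obtain ⟨α, β, γ, δ, w, hdet, hw, h⟩ := h
  have hJ0 := act_jacobian₀ α β γ δ w (ofC d k)
  have hJ1 := act_jacobian₁ α β γ δ w (ofC d k)
  have hJ2 := act_jacobian₂ α β γ δ w (ofC d k)
  rw [← h] at hJ0 hJ1 hJ2
  have hden := congrArg Coeffs.d h
  have hnum := congrArg Coeffs.a h
  simp only [ofC, act, subst, comb, scale] at hJ0 hJ1 hJ2 hden hnum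
  have hne : w ^ 2 * (α * δ - β * γ) ^ 2 * (2 * (d - k ^ 2)) ≠ 0 :=
    mul_ne_zero (mul_ne_zero (pow_ne_zero _ hw) (pow_ne_zero _ hdet))
      (mul_ne_zero h2 (sub_ne_zero.2 hk.symm))
  have h1 : α * β = d * γ * δ := by
    apply mul_left_cancel₀ hne; linear_combination -hJ1
  have h0 : d' * (α ^ 2 - d * γ ^ 2) = d * δ ^ 2 - β ^ 2 := by
    apply mul_left_cancel₀ hne; linear_combination -hJ2 - d' * hJ0
  by_cases hδ : δ = 0
  · subst hδ
    have hβ : β ≠ 0 := by rintro rfl; simp at hdet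
    have hγ : γ ≠ 0 := by rintro rfl; simp at hdet
    have hα : α = 0 := by simpa [hβ] using h1
    subst hα
    have hk0 : k ≠ 0 := by rintro rfl; simp at hden
    refine ⟨0, β / (d * γ), div_ne_zero hβ (mul_ne_zero hd hγ), ?_, Or.inl ⟨hk0, ?_⟩⟩
    · field_simp
      linear_combination -h0
    · field_simp
      linear_combination k * γ * hnum - β * hden
  -- By `h1` the matrix is, up to a scalar, `(1, d b τ; τ, b)` with `b = δ / α`; the parameter of
  -- the statement is `-τ`.
  · obtain ⟨τ, rfl⟩ : ∃ τ, β = d * δ * τ := ⟨β / (d * δ), by field_simp⟩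
    obtain rfl : γ = α * τ := by
      apply mul_left_cancel₀ (mul_ne_zero hd hδ); linear_combination -h1
    have hα : α ≠ 0 := by rintro rfl; simp at hdet
    have hτ : 1 - d * τ ^ 2 ≠ 0 := by
      intro h; apply hdet; linear_combination α * δ * h
    have hD : d * k * (-τ) ^ 3 + 3 * d * (-τ) ^ 2 + 3 * k * (-τ) + 1 ≠ 0 := by
      intro h; apply one_ne_zero (α := F); rw [hden]; linear_combination w * α ^ 3 * h
    refine ⟨-τ, δ / α, div_ne_zero hδ hα, ?_, Or.inr ⟨hD, ?_⟩⟩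
    · field_simp
      apply mul_right_cancel₀ hτ
      linear_combination h0
    · rw [eq_div_iff hD, div_mul_eq_mul_div, eq_div_iff hα]
      have hwα : w * α ^ 2 ≠ 0 := mul_ne_zero hw (pow_ne_zero _ hα)
      apply mul_left_cancel₀ hwα
      linear_combination hnum - k' * hden

theorem rel_ofC_of_params {d k d' k' γ b : F} (hd : d ≠ 0) (hk' : k' ^ 2 ≠ d')
    (hb : b ≠ 0) (hd' : d' = b ^ 2 * d) (h : (k ≠ 0 ∧ k' = b * d / k) ∨
      (d * k * γ ^ 3 + 3 * d * γ ^ 2 + 3 * k * γ + 1 ≠ 0 ∧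
        k' = b * (d ^ 2 * γ ^ 3 + 3 * d * k * γ ^ 2 + 3 * d * γ + k) /
          (d * k * γ ^ 3 + 3 * d * γ ^ 2 + 3 * k * γ + 1))) :
    Rel (ofC d k) (ofC d' k') := by
  subst hd'
  rcases h with ⟨hk, rfl⟩ | ⟨hD, h⟩
  · refine ⟨0, b * d, 1, 0, -1 / (d * k), ?_, ?_, ?_⟩
    · simpa using ⟨hb, hd⟩
    · exact div_ne_zero (by simp) (mul_ne_zero hd hk)
    · simp only [ofC, act, subst, comb, scale]
      ext <;> simp only <;> field_simp <;> ring
  · refine ⟨1, -(d * b * γ), -γ, b, 1 / (d * k * γ ^ 3 + 3 * d * γ ^ 2 + 3 * k * γ + 1), ?_,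
      div_ne_zero one_ne_zero hD, ?_⟩
    -- A singular matrix means `d γ² = 1`; the formula for `k'` then gives `k' γ = b`, whence `k'² =
    -- b² d`, which is excluded.
    · intro h0
      have h1 : 1 - d * γ ^ 2 = 0 := by
        apply (mul_eq_zero.1 (show b * (1 - d * γ ^ 2) = 0 by
          linear_combination h0)).resolve_left hb
      rw [eq_div_iff hD] at h
      have h3 : k' * γ = b := by
        apply mul_right_cancel₀ hD
        linear_combination γ * h - b * (d * γ ^ 2 + 1 + 2 * k * γ) * h1
      apply hk'
      linear_combination k' ^ 2 * h1 + d * (k' * γ + b) * h3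
    · generalize hDD : d * k * γ ^ 3 + 3 * d * γ ^ 2 + 3 * k * γ + 1 = D at *
      subst h
      simp only [ofC, act, subst, comb, scale]
      ext <;> simp only <;> field_simp <;> first | ring1 | (rw [← hDD]; ring1)

/-! ### Descent from the algebraic closure, and the three cases. -/

variable {K : Type*} [Field K]

theorem map_ofA {E : Type*} [Field E] (i : K →+* E) (s t : K) :
    (ofA s t).map i = ofA (i s) (i t) := by
  simp [map, ofA, map_ofNat i 2]

theorem map_ofB {E : Type*} [Field E] (i : K →+* E) (k b : K) :
    (ofB k b).map i = ofB (i k) (i b) := by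
  simp [map, ofB]

theorem map_ofC {E : Type*} [Field E] (i : K →+* E) (d k : K) :
    (ofC d k).map i = ofC (i d) (i k) := by
  simp [map, ofC, map_ofNat i 2]

theorem res_ne_zero_of_ratDegree {q : Coeffs K} (h : ratDegree q.toRat = 2) : q.res ≠ 0 := by
  obtain ⟨q', hq', e⟩ := exists_toRat_of_ratDegree h
  obtain ⟨w, hw, rfl⟩ := eq_scale_of_toRat_eq hq' e.symm
  rw [res_scale]
  exact mul_ne_zero (pow_ne_zero _ hw) hq'

theorem isConj_toBar_iff {q q' : Coeffs K} (hq : q.res ≠ 0) :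
    IsConj (toBar q.toRat) (toBar q'.toRat) ↔
      Rel (q.map (algebraMap K (AlgebraicClosure K)))
        (q'.map (algebraMap K (AlgebraicClosure K))) := by
  rw [toBar_toRat, toBar_toRat, isConj_toRat_iff (res_map_ne_zero _ hq)]

theorem hasMultipliers_iff {q q' : Coeffs K} (hq : q.res ≠ 0) (h : Rel q q')
    {m₁ m₂ m₃ : AlgebraicClosure K}
    (hm : (q'.map (algebraMap K (AlgebraicClosure K))).MultList m₁ m₂ m₃)
    (l₁ l₂ l₃ : AlgebraicClosure K) :
    HasMultipliers q.toRat l₁ l₂ l₃ ↔ ({l₁, l₂, l₃} : Multiset _) = {m₁, m₂, m₃} := by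
  rw [HasMultipliers, toBar_toRat,
    (hm.of_rel (h.map _).symm).multipliers_eq (res_map_ne_zero _ hq), eq_comm]

theorem Rel.hasMultipliers_ofA {q : Coeffs K} (hq : q.res ≠ 0) {s t : K} (h : Rel q (ofA s t)) :
    ∃ m₁ m₂ m₃ : AlgebraicClosure K, algebraMap K _ s = m₁ + m₂ + m₃ ∧
      algebraMap K _ t = m₁ * m₂ + m₁ * m₃ + m₂ * m₃ ∧ CondA m₁ m₂ m₃ ∧
      ∀ l₁ l₂ l₃, HasMultipliers q.toRat l₁ l₂ l₃ ↔
        ({l₁, l₂, l₃} : Multiset _) = {m₁, m₂, m₃} := by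
  have hr := res_map_ne_zero (algebraMap K (AlgebraicClosure K)) (h.res_ne_zero hq)
  rw [map_ofA] at hr
  obtain ⟨m₁, m₂, m₃, hs, ht, hA, hm⟩ := multList_ofA hr
  rw [← map_ofA] at hm
  exact ⟨m₁, m₂, m₃, hs, ht, hA, hasMultipliers_iff hq h hm⟩

theorem Rel.hasMultipliers_ofB {q : Coeffs K} (hq : q.res ≠ 0) {k b : K} (hk : k ≠ 0) (hb : b ≠ 0)
    (h : Rel q (ofB k b)) (l₁ l₂ l₃ : AlgebraicClosure K) :
    HasMultipliers q.toRat l₁ l₂ l₃ ↔ ({l₁, l₂, l₃} : Multiset _) =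
      {2 * algebraMap K _ k - 1, 2 * algebraMap K _ k - 1, 1 / algebraMap K _ k} := by
  have hm := multList_ofB ((map_ne_zero (algebraMap K (AlgebraicClosure K))).2 hk)
    ((map_ne_zero (algebraMap K (AlgebraicClosure K))).2 hb)
  rw [← map_ofB] at hm
  exact hasMultipliers_iff hq h hm _ _ _

theorem Rel.hasMultipliers_ofC {q : Coeffs K} (hq : q.res ≠ 0) {d k : K} (h : Rel q (ofC d k))
    (l₁ l₂ l₃ : AlgebraicClosure K) :
    HasMultipliers q.toRat l₁ l₂ l₃ ↔ ({l₁, l₂, l₃} : Multiset _) = {-2, -2, -2} := by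
  have hm := multList_ofC (algebraMap K (AlgebraicClosure K) d) (algebraMap K _ k)
  rw [← map_ofC] at hm
  exact hasMultipliers_iff hq h hm _ _ _

end Coeffs

open Coeffs

variable {K : Type*} [Field K]

theorem algebraMap_ne_neg_half {k : K} (hk : k ≠ -1 / 2) :
    algebraMap K (AlgebraicClosure K) k ≠ -1 / 2 := by
  intro h
  apply hk
  apply (algebraMap K (AlgebraicClosure K)).injective
  rw [h]; simp [map_ofNat (algebraMap K (AlgebraicClosure K)) 2]

theorem inCaseA_of_rel {q : Coeffs K} (hq : q.res ≠ 0) {s t : K} (h : Rel q (ofA s t)) :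
    InCaseA q.toRat := by
  obtain ⟨m₁, m₂, m₃, -, -, hA, hm⟩ := h.hasMultipliers_ofA hq
  exact ⟨m₁, m₂, m₃, (hm _ _ _).2 rfl, hA⟩

theorem inCaseB_of_rel (h2 : (2 : K) ≠ 0) {q : Coeffs K} (hq : q.res ≠ 0) {k b : K} (hk : k ≠ 0)
    (hk' : k ≠ -1 / 2) (hb : b ≠ 0) (h : Rel q (ofB k b)) : InCaseB q.toRat := by
  refine ⟨_, _, _, (h.hasMultipliers_ofB hq hk hb _ _ _).2 rfl, condB_ofB ?_ ?_ ?_⟩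
  · simpa [map_ofNat (algebraMap K (AlgebraicClosure K)) 2] using
      (map_ne_zero (algebraMap K (AlgebraicClosure K))).2 h2
  · simpa using hk
  · exact algebraMap_ne_neg_half hk'

theorem inCaseC_of_rel {q : Coeffs K} (hq : q.res ≠ 0) {d k : K} (h : Rel q (ofC d k)) :
    InCaseC q.toRat :=
  ⟨_, _, _, (h.hasMultipliers_ofC hq _ _ _).2 rfl, rfl, rfl, rfl⟩

theorem not_inCaseA_inCaseB (ψ : RatFunc K) : ¬ (InCaseA ψ ∧ InCaseB ψ) := by
  rintro ⟨⟨l₁, l₂, l₃, hl, hA⟩, m₁, m₂, m₃, hm, hB⟩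
  exact not_condA_condB (hl.symm.trans hm) hA hB

theorem not_inCaseA_inCaseC (ψ : RatFunc K) : ¬ (InCaseA ψ ∧ InCaseC ψ) := by
  rintro ⟨⟨l₁, l₂, l₃, hl, hA⟩, m₁, m₂, m₃, hm, hC⟩
  exact not_condA_condC (hl.symm.trans hm) hA hC

theorem not_inCaseB_inCaseC (h3 : (3 : K) ≠ 0) (ψ : RatFunc K) :
    ¬ (InCaseB ψ ∧ InCaseC ψ) := by
  rintro ⟨⟨l₁, l₂, l₃, hl, hB⟩, m₁, m₂, m₃, hm, hC⟩
  refine not_condB_condC ?_ (hl.symm.trans hm) hB hC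
  simpa [map_ofNat (algebraMap K (AlgebraicClosure K)) 3] using
    (map_ne_zero (algebraMap K (AlgebraicClosure K))).2 h3

/-- No normal form is reconstructed from multipliers: some normal form exists over `K`, and a wrong
one would put the map in two exclusive cases. -/
theorem inCaseA_iff (h2 : (2 : K) ≠ 0) {q : Coeffs K} (hq : q.res ≠ 0) :
    InCaseA q.toRat ↔ ∃ s t, Rel q (ofA s t) := by
  refine ⟨fun hA ↦ ?_, fun ⟨s, t, h⟩ ↦ inCaseA_of_rel hq h⟩
  rcases rel_normal_form h2 hq with h | ⟨k, b, hk, hk', hb, h⟩ | ⟨d, k, hd, hk, h⟩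
  · exact h
  · exact (not_inCaseA_inCaseB _ ⟨hA, inCaseB_of_rel h2 hq hk hk' hb h⟩).elim
  · exact (not_inCaseA_inCaseC _ ⟨hA, inCaseC_of_rel hq h⟩).elim

theorem inCaseB_iff (h2 : (2 : K) ≠ 0) (h3 : (3 : K) ≠ 0) {q : Coeffs K} (hq : q.res ≠ 0) :
    InCaseB q.toRat ↔ ∃ k b, k ≠ 0 ∧ k ≠ -1 / 2 ∧ b ≠ 0 ∧ Rel q (ofB k b) := by
  refine ⟨fun hB ↦ ?_, fun ⟨k, b, hk, hk', hb, h⟩ ↦ inCaseB_of_rel h2 hq hk hk' hb h⟩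
  rcases rel_normal_form h2 hq with ⟨s, t, h⟩ | h | ⟨d, k, hd, hk, h⟩
  · exact (not_inCaseA_inCaseB _ ⟨inCaseA_of_rel hq h, hB⟩).elim
  · exact h
  · exact (not_inCaseB_inCaseC h3 _ ⟨hB, inCaseC_of_rel hq h⟩).elim

theorem inCaseC_iff (h2 : (2 : K) ≠ 0) (h3 : (3 : K) ≠ 0) {q : Coeffs K} (hq : q.res ≠ 0) :
    InCaseC q.toRat ↔ ∃ d k, d ≠ 0 ∧ k ^ 2 ≠ d ∧ Rel q (ofC d k) := by
  refine ⟨fun hC ↦ ?_, fun ⟨d, k, _, _, h⟩ ↦ inCaseC_of_rel hq h⟩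
  rcases rel_normal_form h2 hq with ⟨s, t, h⟩ | ⟨k, b, hk, hk', hb, h⟩ | h
  · exact (not_inCaseA_inCaseC _ ⟨inCaseA_of_rel hq h, hC⟩).elim
  · exact (not_inCaseB_inCaseC h3 _ ⟨inCaseB_of_rel h2 hq hk hk' hb h, hC⟩).elim
  · exact h

theorem inCase_exhaustive (h2 : (2 : K) ≠ 0) {q : Coeffs K} (hq : q.res ≠ 0) :
    InCaseA q.toRat ∨ InCaseB q.toRat ∨ InCaseC q.toRat := by
  rcases rel_normal_form h2 hq with ⟨s, t, h⟩ | ⟨k, b, hk, hk', hb, h⟩ | ⟨d, k, hd, hk, h⟩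
  · exact Or.inl (inCaseA_of_rel hq h)
  · exact Or.inr (Or.inl (inCaseB_of_rel h2 hq hk hk' hb h))
  · exact Or.inr (Or.inr (inCaseC_of_rel hq h))

theorem exists_rel_ofA (h2 : (2 : K) ≠ 0) {q : Coeffs K} (hq : q.res ≠ 0)
    {l₁ l₂ l₃ : AlgebraicClosure K} (hl : HasMultipliers q.toRat l₁ l₂ l₃) (hA : CondA l₁ l₂ l₃) :
    ∃ s t : K, algebraMap K (AlgebraicClosure K) s = l₁ + l₂ + l₃ ∧
      algebraMap K (AlgebraicClosure K) t = l₁ * l₂ + l₁ * l₃ + l₂ * l₃ ∧ Rel q (ofA s t) := by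
  obtain ⟨s, t, h⟩ := (inCaseA_iff h2 hq).1 ⟨l₁, l₂, l₃, hl, hA⟩
  obtain ⟨m₁, m₂, m₃, hs, ht, -, hm⟩ := h.hasMultipliers_ofA hq
  refine ⟨s, t, ?_, ?_, h⟩
  · rw [hs]
    rcases multiset_triple_eq ((hm _ _ _).1 hl) with h | h | h | h | h | h <;>
      obtain ⟨rfl, rfl, rfl⟩ := h <;> ring
  · rw [ht]
    rcases multiset_triple_eq ((hm _ _ _).1 hl) with h | h | h | h | h | h <;>
      obtain ⟨rfl, rfl, rfl⟩ := h <;> ring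

theorem exists_rel_ofB (h2 : (2 : K) ≠ 0) (h3 : (3 : K) ≠ 0) {q : Coeffs K} (hq : q.res ≠ 0)
    {l₁ l₂ l₃ : AlgebraicClosure K} (hl : HasMultipliers q.toRat l₁ l₂ l₃) (hB : CondB l₁ l₂ l₃) :
    ∃ k b : K, k ≠ 0 ∧ k ≠ -1 / 2 ∧ b ≠ 0 ∧
      algebraMap K (AlgebraicClosure K) k = (l₁ + 1) / 2 ∧ Rel q (ofB k b) := by
  obtain ⟨k, b, hk, hk', hb, h⟩ := (inCaseB_iff h2 h3 hq).1 ⟨l₁, l₂, l₃, hl, hB⟩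
  refine ⟨k, b, hk, hk', hb, ?_, h⟩
  have h2' : (2 : AlgebraicClosure K) ≠ 0 := by
    simpa [map_ofNat (algebraMap K (AlgebraicClosure K)) 2] using
      (map_ne_zero (algebraMap K (AlgebraicClosure K))).2 h2
  have h12 : l₁ = l₂ := by
    rcases hB with h | h
    · exact h.1
    · exact h.1.trans h.2.1.symm
  rw [eq_div_iff h2']
  rcases multiset_triple_eq ((h.hasMultipliers_ofB hq hk hb _ _ _).1 hl) with
    h | h | h | h | h | h <;> obtain ⟨e1, e2, -⟩ := h
  · linear_combination -e1
  · linear_combination -e1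
  · linear_combination -e1
  · linear_combination -e1
  -- In the last two matchings `l₁` is paired with `1 / k`, but `l₂ = l₁` is paired with `2 k - 1`.
  · linear_combination -e2 - h12
  · linear_combination -e2 - h12

end QuadraticMaps

end

open QuadraticMaps QuadraticMaps.Coeffs in
theorem theorem1 (K : Type*) [Field K] (hK2 : ringChar K ≠ 2) (hK3 : ringChar K ≠ 3) :
    -- (a)
    ((∀ (ψ : RatFunc K) (l₁ l₂ l₃ : AlgebraicClosure K),
        QuadraticMaps.ratDegree ψ = 2 → QuadraticMaps.HasMultipliers ψ l₁ l₂ l₃ →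
        QuadraticMaps.CondA l₁ l₂ l₃ →
        ∃ s t : K, algebraMap K (AlgebraicClosure K) s = l₁ + l₂ + l₃ ∧
          algebraMap K (AlgebraicClosure K) t = l₁ * l₂ + l₁ * l₃ + l₂ * l₃ ∧
          QuadraticMaps.IsConj ψ (QuadraticMaps.formA s t)) ∧
      (∀ s t s' t' : K,
        QuadraticMaps.ratDegree (QuadraticMaps.formA s t) = 2 →
        QuadraticMaps.ratDegree (QuadraticMaps.formA s' t') = 2 →
        QuadraticMaps.IsConj (QuadraticMaps.toBar (QuadraticMaps.formA s t))
          (QuadraticMaps.toBar (QuadraticMaps.formA s' t')) →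
        s = s' ∧ t = t')) ∧
    -- (b)
    ((∀ (ψ : RatFunc K) (l₁ l₂ l₃ : AlgebraicClosure K),
        QuadraticMaps.ratDegree ψ = 2 → QuadraticMaps.HasMultipliers ψ l₁ l₂ l₃ →
        QuadraticMaps.CondB l₁ l₂ l₃ →
        ∃ k b : K, k ≠ 0 ∧ k ≠ -1 / 2 ∧ b ≠ 0 ∧
          algebraMap K (AlgebraicClosure K) k = (l₁ + 1) / 2 ∧
          QuadraticMaps.IsConj ψ (QuadraticMaps.formB k b)) ∧
      (∀ k b k' b' : K, k ≠ 0 → k ≠ -1 / 2 → b ≠ 0 → k' ≠ 0 → k' ≠ -1 / 2 → b' ≠ 0 →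
        (QuadraticMaps.IsConj (QuadraticMaps.toBar (QuadraticMaps.formB k b))
            (QuadraticMaps.toBar (QuadraticMaps.formB k' b')) ↔ k = k') ∧
        (QuadraticMaps.IsConj (QuadraticMaps.formB k b) (QuadraticMaps.formB k' b') ↔
          k = k' ∧ ∃ c : K, c ≠ 0 ∧ b / b' = c ^ 2))) ∧
    -- (c)
    ((∀ (ψ : RatFunc K) (l₁ l₂ l₃ : AlgebraicClosure K),
        QuadraticMaps.ratDegree ψ = 2 → QuadraticMaps.HasMultipliers ψ l₁ l₂ l₃ →
        QuadraticMaps.CondC l₁ l₂ l₃ →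
        ∃ d k : K, d ≠ 0 ∧ k ^ 2 ≠ d ∧ QuadraticMaps.IsConj ψ (QuadraticMaps.formC d k)) ∧
      (∀ d k d' k' : K, d ≠ 0 → k ^ 2 ≠ d → d' ≠ 0 → k' ^ 2 ≠ d' →
        QuadraticMaps.IsConj (QuadraticMaps.toBar (QuadraticMaps.formC d k))
            (QuadraticMaps.toBar (QuadraticMaps.formC d' k')) ∧
        (QuadraticMaps.IsConj (QuadraticMaps.formC d k) (QuadraticMaps.formC d' k') ↔
          ∃ γ b : K, b ≠ 0 ∧ d' = b ^ 2 * d ∧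
            ((k ≠ 0 ∧ k' = b * d / k) ∨
              (d * k * γ ^ 3 + 3 * d * γ ^ 2 + 3 * k * γ + 1 ≠ 0 ∧
                k' = b * (d ^ 2 * γ ^ 3 + 3 * d * k * γ ^ 2 + 3 * d * γ + k) /
                  (d * k * γ ^ 3 + 3 * d * γ ^ 2 + 3 * k * γ + 1)))))) ∧
    -- every quadratic map is in exactly one case, and the three lists of normal forms are complete
    (∀ ψ : RatFunc K, QuadraticMaps.ratDegree ψ = 2 →
      (QuadraticMaps.InCaseA ψ ∨ QuadraticMaps.InCaseB ψ ∨ QuadraticMaps.InCaseC ψ) ∧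
      ¬ (QuadraticMaps.InCaseA ψ ∧ QuadraticMaps.InCaseB ψ) ∧
      ¬ (QuadraticMaps.InCaseA ψ ∧ QuadraticMaps.InCaseC ψ) ∧
      ¬ (QuadraticMaps.InCaseB ψ ∧ QuadraticMaps.InCaseC ψ) ∧
      (QuadraticMaps.InCaseA ψ ↔ ∃ s t : K, QuadraticMaps.IsConj ψ (QuadraticMaps.formA s t)) ∧
      (QuadraticMaps.InCaseB ψ ↔ ∃ k b : K, k ≠ 0 ∧ k ≠ -1 / 2 ∧ b ≠ 0 ∧
        QuadraticMaps.IsConj ψ (QuadraticMaps.formB k b)) ∧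
      (QuadraticMaps.InCaseC ψ ↔ ∃ d k : K, d ≠ 0 ∧ k ^ 2 ≠ d ∧
        QuadraticMaps.IsConj ψ (QuadraticMaps.formC d k))) ∧
    -- the normal forms of (b) and (c) are quadratic
    (∀ k b : K, k ≠ 0 → b ≠ 0 → QuadraticMaps.ratDegree (QuadraticMaps.formB k b) = 2) ∧
    (∀ d k : K, d ≠ 0 → k ^ 2 ≠ d → QuadraticMaps.ratDegree (QuadraticMaps.formC d k) = 2) := by
  have h2 : (2 : K) ≠ 0 := Ring.two_ne_zero hK2
  have h3 : (3 : K) ≠ 0 := by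
    intro h
    have hdvd : ringChar K ∣ 3 := ringChar.dvd (by exact_mod_cast h)
    rcases (Nat.dvd_prime Nat.prime_three).1 hdvd with h1 | h1
    · have := ringChar.spec K 1
      rw [h1] at this
      simp at this
    · exact hK3 h1
  have h2' : (2 : AlgebraicClosure K) ≠ 0 := by
    simpa [map_ofNat (algebraMap K (AlgebraicClosure K)) 2] using
      (map_ne_zero (algebraMap K (AlgebraicClosure K))).2 h2
  simp only [← toRat_ofA, ← toRat_ofB, ← toRat_ofC]
  refine ⟨⟨?_, ?_⟩, ⟨?_, ?_⟩, ⟨?_, ?_⟩, ?_, ?_, ?_⟩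
  · intro ψ l₁ l₂ l₃ hψ hl hA
    obtain ⟨q, hq, rfl⟩ := exists_toRat_of_ratDegree hψ
    obtain ⟨s, t, hs, ht, h⟩ := exists_rel_ofA h2 hq hl hA
    exact ⟨s, t, hs, ht, (isConj_toRat_iff hq).2 h⟩
  · intro s t s' t' hd hd' h
    have hr := res_ne_zero_of_ratDegree hd
    rw [isConj_toBar_iff hr, map_ofA, map_ofA] at h
    have hr' := res_map_ne_zero (algebraMap K (AlgebraicClosure K)) hr
    rw [map_ofA] at hr'
    have := h.ofA_injective hr'
    exact ⟨(algebraMap K _).injective this.1, (algebraMap K _).injective this.2⟩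
  · intro ψ l₁ l₂ l₃ hψ hl hB
    obtain ⟨q, hq, rfl⟩ := exists_toRat_of_ratDegree hψ
    obtain ⟨k, b, hk, hk', hb, e, h⟩ := exists_rel_ofB h2 h3 hq hl hB
    exact ⟨k, b, hk, hk', hb, e, (isConj_toRat_iff hq).2 h⟩
  · intro k b k' b' hk hkh hb hk' hkh' hb'
    have hr := res_ofB_ne_zero hk hb
    have hbar : QuadraticMaps.IsConj (QuadraticMaps.toBar (ofB k b).toRat)
        (QuadraticMaps.toBar (ofB k' b').toRat) ↔ k = k' := by
      rw [isConj_toBar_iff hr, map_ofB, map_ofB]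
      have n {x : K} (hx : x ≠ 0) : algebraMap K (AlgebraicClosure K) x ≠ 0 :=
        (map_ne_zero _).2 hx
      constructor
      · intro h
        exact (algebraMap K _).injective (h.ofB_fst_eq h2' (n hk) (n hb) (n hk') (n hb'))
      · rintro rfl
        rw [rel_ofB_iff h2' (QuadraticMaps.algebraMap_ne_neg_half hkh) (n hb) (n hb')]
        obtain ⟨c, hc⟩ := IsAlgClosed.exists_pow_nat_eq
          (algebraMap K (AlgebraicClosure K) b / algebraMap K _ b') two_pos
        refine ⟨c, ?_, hc.symm⟩
        rintro rfl
        exact div_ne_zero (n hb) (n hb') (by rw [← hc]; simp)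
    refine ⟨hbar, ?_⟩
    rw [isConj_toRat_iff hr]
    constructor
    · intro h
      -- Equality of `k` and `k'` is inherited from the closure, where multipliers determine it;
      -- only the square class of `b / b'` is seen over `K`.
      obtain rfl := hbar.1 ((isConj_toBar_iff hr).2 (h.map _))
      exact ⟨rfl, (rel_ofB_iff h2 hkh hb hb').1 h⟩
    · rintro ⟨rfl, h⟩
      exact (rel_ofB_iff h2 hkh hb hb').2 h
  · intro ψ l₁ l₂ l₃ hψ hl hC
    obtain ⟨q, hq, rfl⟩ := exists_toRat_of_ratDegree hψ
    obtain ⟨d, k, hd, hk, h⟩ := (inCaseC_iff h2 h3 hq).1 ⟨l₁, l₂, l₃, hl, hC⟩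
    exact ⟨d, k, hd, hk, (isConj_toRat_iff hq).2 h⟩
  · intro d k d' k' hd hk hd' hk'
    have hr := res_ofC_ne_zero h2 hd hk
    constructor
    · have key {d k : K} (hd : d ≠ 0) (hk : k ^ 2 ≠ d) :=
        rel_ofC_inv_sq h2' (d := algebraMap K (AlgebraicClosure K) d) (k := algebraMap K _ k)
          ((map_ne_zero _).2 hd)
          (by rw [← map_pow]; exact fun h ↦ hk ((algebraMap K _).injective h))
      rw [isConj_toBar_iff hr, map_ofC, map_ofC]
      exact (key hd hk).trans (key hd' hk').symm
    · rw [isConj_toRat_iff hr]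
      constructor
      · exact Rel.ofC_params h2 hd hk
      · rintro ⟨γ, b, hb, e, h⟩
        exact rel_ofC_of_params hd hk' hb e h
  · intro ψ hψ
    obtain ⟨q, hq, rfl⟩ := exists_toRat_of_ratDegree hψ
    simp only [isConj_toRat_iff hq]
    exact ⟨inCase_exhaustive h2 hq, not_inCaseA_inCaseB _, not_inCaseA_inCaseC _,
      not_inCaseB_inCaseC h3 _, inCaseA_iff h2 hq, inCaseB_iff h2 h3 hq, inCaseC_iff h2 h3 hq⟩
  · intro k b hk hb
    exact ratDegree_toRat (res_ofB_ne_zero hk hb)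
  · intro d k hd hk
    exact ratDegree_toRat (res_ofC_ne_zero h2 hd hk)
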